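/- **Setting.** Let $E$ be a finite-dimensional real normed space (i.e. $\mathbb R^d$ with an arbitrary norm) with Lebesgue (Haar) measure $\mathrm d\omega$, let $\rho>0$, let $\mathbb B_\rho(z)$ be the closed ball of radius $\rho$ around $z$ and $\mathsf V_\rho$ its volume. Let $\mathcal Z\subseteq E$ be a measurable set and $\hat{\mathbb P}$ a probability measure on $\mathcal Z$ such that $\mathbb B_\rho(z)\subseteq\mathcal Z$ for $\hat{\mathbb P}$-a.e. $z$. Let $\nu_z$ be the uniform distribution on $\mathbb B_\rho(z)$ and $\mathrm d\gamma_0(z,z')=\mathrm d\hat{\mathbb P}(z)\,\mathrm d\nu_z(z')$. Let $\phi:\mathbb R\to[0,\infty]$ be convex and lower semicontinuous with $\phi(1)=0$ and $\phi(x)=\infty$ for $x<0$. Assume that $\phi(t)<\infty$ for some $t<1$ or $\phi(t)=\infty$ for some $t>1$ (that is, the domain of $\phi$ is not $[1,\infty)$). Put $\mathbb D_\phi(\gamma,\gamma_0)=\mathbb E_{\gamma_0}[\phi(\mathrm d\gamma/\mathrm d\gamma_0)]$ if $\gamma\ll\gamma_0$ and $\mathbb D_\phi(\gamma,\gamma_0)=\infty$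 otherwise, and $(\eta\phi)^*(s)=\sup_{t\in\mathbb R}\{st-\eta\phi(t)\}$ for $s\in\mathbb R\cup\{\infty\}$. Expectations of extended real valued functions are differences of the expectations of the positive and the negative part, with $\infty-\infty=-\infty$. Let $f:\mathcal Z\to\mathbb R\cup\{\infty\}$ be measurable. Call $(\mathbb P,\gamma)$ feasible if $\gamma$ is a probability measure on $\mathcal Z\times\mathcal Z$ with first marginal $\hat{\mathbb P}$ and second marginal $\mathbb P$, and $\operatorname{ess\,sup}_{(\zeta_1,\zeta_2)\sim\gamma}\|\zeta_1-\zeta_2\|\le\rho$. Assume that every probability measure $\gamma$ on $\mathcal Z\times\mathcal Z$ with first marginal $\hat{\mathbb P}$ has a regular conditional distribution given its first coordinate, and that the primal problem is proper: some feasible $(\mathbb P,\gamma)$ has $\mathbb E_{\mathbb P}[f^-]<\infty$ and $\mathbb D_\phi(\gamma,\gamma_0)<\infty$ (for instance, $\gamma=\gamma_0$ will do if $\mathbb E_{(z,z')\sim\gamma_0}[f^-(z')]<\infty$). **Theorem (Strong Duality).** For every $\eta>0$: 1. $$\sup_{(\mathbb P,\gamma)\text{ feasible}}\Big\{\mathbb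 E_{\mathbb P}[f]-\eta\,\mathbb D_\phi(\gamma,\gamma_0)\Big\}=\mathbb E_{z\sim\hat{\mathbb P}}\Big[\inf_{\mu\in\mathbb R}\big\{\mu+\mathbb E_{z'\sim\nu_z}[(\eta\phi)^*(f(z')-\mu)]\big\}\Big]$$ in $[-\infty,\infty]$. 2. Assume in addition that for $\hat{\mathbb P}$-a.e. $z$ there are given a number $\mu_z^*\in\mathbb R$ and a function $\zeta_z^*$, with $(z,\omega)\mapsto\zeta_z^*(\omega)$ measurable, such that $$\zeta_z^*\ge0,\qquad \mathbb E_{\nu_z}[\zeta_z^*]=1,\qquad \zeta_z^*(\omega)\in\partial(\eta\phi)^*\big(f(\omega)-\mu_z^*\big)\ \text{ for }\nu_z\text{-a.e. }\omega$$ (so $\zeta_z^*(\omega)=(\eta\phi)^{*\prime}(f(\omega)-\mu_z^*)$ wherever the derivative exists), and that the primal objective is not of the form $\infty-\infty$ at $\mathrm d\gamma^*(z,\omega)=\zeta_z^*(\omega)\,\mathrm d\gamma_0(z,\omega)$, that is, $\mathbb E_{\gamma_0}[f^+(\omega)\zeta_z^*(\omega)]<\infty$, or both $\mathbb E_{\gamma_0}[f^-(\omega)\zeta_z^*(\omega)]<\infty$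 and $\mathbb E_{\gamma_0}[\phi(\zeta_z^*(\omega))]<\infty$. Then the distribution $\mathbb P_*$ with density $$\frac{\mathrm d\mathbb P_*(\omega)}{\mathrm d\omega}=\mathsf V_\rho^{-1}\,\mathbb E_{z\sim\hat{\mathbb P}}\big[\mathbf 1\{\omega\in\mathbb B_\rho(z)\}\,\zeta_z^*(\omega)\big]$$ is a worst-case distribution: there is $\gamma$ such that $(\mathbb P_*,\gamma)$ is feasible and attains the supremum in 1. -/

import Mathlib

open MeasureTheory ProbabilityTheory Metric
open scoped ENNReal NNReal

noncomputable section

namespace PhiRegDRO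

/-- A divergence function: a convex lower semicontinuous `φ : ℝ → [0, ∞]` with `φ 1 = 0` and
`φ x = ∞` for `x < 0`. -/
structure IsDivergenceFunction (φ : ℝ → ℝ≥0∞) : Prop where
  convex : ∀ x y a b : ℝ, 0 ≤ a → 0 ≤ b → a + b = 1 →
    φ (a * x + b * y) ≤ ENNReal.ofReal a * φ x + ENNReal.ofReal b * φ y
  lowerSemicontinuous : LowerSemicontinuous φ
  map_one : φ 1 = 0
  map_neg : ∀ x : ℝ, x < 0 → φ x = ⊤

/-- The convex conjugate `(ηφ)^*(s) = sup_t (s t - η φ(t))` for extended real `s`. -/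
def conj (η : ℝ) (φ : ℝ → ℝ≥0∞) (s : EReal) : EReal :=
  ⨆ t : ℝ, (s * (t : EReal) - (η : EReal) * ((φ t : ℝ≥0∞) : EReal))

/-- `ζ` is a subgradient of the convex function `(ηφ)^*` at the point `s`, which has to be a real
number at which `(ηφ)^*` is finite. Where `(ηφ)^*` is differentiable, the only subgradient is the
derivative. -/
def IsConjSubgradient (η : ℝ) (φ : ℝ → ℝ≥0∞) (s : EReal) (ζ : ℝ) : Prop :=
  ∃ r : ℝ, s = (r : EReal) ∧ conj η φ (r : EReal) ≠ ⊤ ∧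
    ∀ r' : ℝ, conj η φ (r : EReal) + ((ζ * (r' - r) : ℝ) : EReal) ≤ conj η φ (r' : EReal)

/-- Expectation of an extended real valued function: the integral of the positive part minus the
integral of the negative part (with the value `-∞` when both of them are infinite). -/
def expect {α : Type*} [MeasurableSpace α] (m : Measure α) (g : α → EReal) : EReal :=
  ((∫⁻ x, (g x).toENNReal ∂m : ℝ≥0∞) : EReal) - ((∫⁻ x, (-g x).toENNReal ∂m : ℝ≥0∞) : EReal)

open scoped Classical in
/-- The `φ`-divergence `E_{γ₀}[φ(dγ/dγ₀)]`, equal to `∞` unless `γ` has a density with respect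
to `γ₀`. -/
def phiDiv {α : Type*} [MeasurableSpace α] (φ : ℝ → ℝ≥0∞) (γ γ₀ : Measure α) : ℝ≥0∞ :=
  if γ ≪ γ₀ then ∫⁻ p, φ ((γ.rnDeriv γ₀ p).toReal) ∂γ₀ else ⊤

variable {E : Type*} [NormedAddCommGroup E] [MeasurableSpace E]

/-- The restriction to the space `𝒵 ⊆ E` of the volume of `E`. -/
def volOn (vol : Measure E) (𝒵 : Set E) : Measure 𝒵 :=
  vol.comap ((↑) : 𝒵 → E)

/-- The volume of a closed ball of radius `ρ`. -/
def ballVol (vol : Measure E) (ρ : ℝ) : ℝ≥0∞ :=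
  vol (closedBall (0 : E) ρ)

/-- The reference measure `ν_z`: uniform on the closed ball of radius `ρ` around `z`. -/
def unifBall (vol : Measure E) (𝒵 : Set E) (ρ : ℝ) (z : 𝒵) : Measure 𝒵 :=
  (volOn vol 𝒵).withDensity fun ω =>
    (ballVol vol ρ)⁻¹ * (closedBall (z : E) ρ).indicator 1 (ω : E)

/-- The reference transport `dγ₀(z, z') = dP̂(z) dν_z(z')`. -/
def refTransport (vol : Measure E) (𝒵 : Set E) (ρ : ℝ) (Phat : Measure 𝒵) : Measure (𝒵 × 𝒵) :=
  Phat.bind fun z => (unifBall vol 𝒵 ρ z).map (Prod.mk z)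

/-- Feasibility of `(P, γ)`: the marginals of `γ` are `P̂` and `P`, and the `γ`-essential supremum
of `‖ζ₁ - ζ₂‖` is at most `ρ`. -/
structure IsFeasible (𝒵 : Set E) (ρ : ℝ) (Phat P : Measure 𝒵) (γ : Measure (𝒵 × 𝒵)) : Prop where
  fst_eq : γ.fst = Phat
  snd_eq : γ.snd = P
  essSup_le : essSup (fun p : 𝒵 × 𝒵 => ‖(p.1 : E) - (p.2 : E)‖ₑ) γ ≤ ENNReal.ofReal ρ

/-- The objective `E_P[f] - η D_φ(γ, γ₀)`. -/
def objective (vol : Measure E) (𝒵 : Set E) (ρ : ℝ) (Phat : Measure 𝒵) (φ : ℝ → ℝ≥0∞)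
    (f : 𝒵 → EReal) (η : ℝ) (P : Measure 𝒵) (γ : Measure (𝒵 × 𝒵)) : EReal :=
  expect P f - (η : EReal) * ((phiDiv φ γ (refTransport vol 𝒵 ρ Phat) : ℝ≥0∞) : EReal)

/-- The optimal value of the regularized primal problem. -/
def primalValue (vol : Measure E) (𝒵 : Set E) (ρ : ℝ) (Phat : Measure 𝒵) (φ : ℝ → ℝ≥0∞)
    (f : 𝒵 → EReal) (η : ℝ) : EReal :=
  sSup {v | ∃ (P : Measure 𝒵) (γ : Measure (𝒵 × 𝒵)), IsFeasible 𝒵 ρ Phat P γ ∧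
    v = objective vol 𝒵 ρ Phat φ f η P γ}

/-- The optimal value of the dual problem. -/
def dualValue (vol : Measure E) (𝒵 : Set E) (ρ : ℝ) (Phat : Measure 𝒵) (φ : ℝ → ℝ≥0∞)
    (f : 𝒵 → EReal) (η : ℝ) : EReal :=
  expect Phat fun z => ⨅ μ : ℝ,
    ((μ : EReal) + expect (unifBall vol 𝒵 ρ z) fun ω => conj η φ (f ω - (μ : EReal)))

/-- `P` is a worst-case distribution: the first component of an optimal solution `(P, γ)` of the
primal problem. -/
def IsWorstCase (vol : Measure E) (𝒵 : Set E) (ρ : ℝ) (Phat : Measure 𝒵) (φ : ℝ → ℝ≥0∞)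
    (f : 𝒵 → EReal) (η : ℝ) (P : Measure 𝒵) : Prop :=
  ∃ γ : Measure (𝒵 × 𝒵), IsFeasible 𝒵 ρ Phat P γ ∧
    objective vol 𝒵 ρ Phat φ f η P γ = primalValue vol 𝒵 ρ Phat φ f η

/-- The measure with density `ω ↦ V_ρ⁻¹ E_{z ∼ P̂}[1{ω ∈ B_ρ(z)} ζ_z(ω)]`. -/
def worstCase (vol : Measure E) (𝒵 : Set E) (ρ : ℝ) (Phat : Measure 𝒵) (ζ : 𝒵 → 𝒵 → ℝ) :
    Measure 𝒵 :=
  (volOn vol 𝒵).withDensity fun ω => (ballVol vol ρ)⁻¹ *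
    ∫⁻ z, (closedBall (z : E) ρ).indicator 1 (ω : E) * ENNReal.ofReal (ζ z ω) ∂Phat

end PhiRegDRO

end

/-!
The reference transport is `γ₀ = P̂ ⊗ ν`, with `ν_z` uniform on a ball, so a feasible transport of
finite divergence is a density `ζ` with `E_{ν_z}[ζ(z, ·)] = 1` for almost every `z`, and the primal
problem splits into one problem for each `z`. On the fibre over `z`, the Lagrange multiplier `μ` of
the normalization turns the problem into the maximization of `(f - μ) ζ - η φ(ζ)` at each point,
whose value is `(ηφ)^*(f - μ)`.

Weak duality (`lintegral_gain_le_expect_fibreDual`) and the optimality of densities made of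
subgradients (`expect_fibreDual_le_lintegral_gain`) follow from `μ` dropping out of the expected
gain (`add_expect_gain`) together with the Fenchel inequality, respectively the Fenchel equality
(`IsConjSubgradient.conj_le`).

For strong duality (`expect_fibreDual_le`) there is a density `ζ₀` with a finite negative part of
the objective. If `φ` is finite on both sides of `1`, `ζ₀` is overwritten by constants `t` on the
sets `{f ≥ -n}`, with `t` in a sequence along which the graph of `φ` is dense. Choosing at each
point the best of finitely many of these densities for a rational slope `q` gives gains which
increase to `(ηφ)^*(f - q)`. So on each fibre the points (mass, gain) of countably many densities
have no supporting line below the dual value, and by the two-dimensional duality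
`exists_chord_gt` two of them have a mixture of mass `1` which comes arbitrarily close to the dual
value. These mixtures form one countable family of jointly measurable functions, so no measurable
selection theorem is needed: the best of the first `n` of them on each fibre is measurable in `z`,
and monotone convergence concludes (`expect_fibreDual_le_of_family`).

Otherwise the domain of `φ` is bounded and on one side of `1`, the only normalized density is `1`,
and the dual function tends to `E_{ν_z}[f]` as `μ → ±∞` (`fibreDual_le_expect`). Only here is it
needed that the domain is not `[1, ∞)`.

Infinite values are handled by writing extended real integrands as differences of functions with
values in `[0, ∞]` (`expect_coe_sub_coe`) and lower bounds of gains as real functions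
(`Admissible`).
-/

namespace PhiRegDRO

/-! ### Expectations of extended real valued functions -/

section Expectation

variable {α : Type*} [MeasurableSpace α] {m : Measure α}

theorem expect_mono_ae {g h : α → EReal} (hgh : ∀ᵐ x ∂m, g x ≤ h x) :
    expect m g ≤ expect m h := by
  refine EReal.sub_le_sub (EReal.coe_ennreal_le_coe_ennreal_iff.2 (lintegral_mono_ae ?_))
    (EReal.coe_ennreal_le_coe_ennreal_iff.2 (lintegral_mono_ae ?_))
  · filter_upwards [hgh] with x hx using EReal.toENNReal_le_toENNReal hx
  · filter_upwards [hgh] with x hx using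
      EReal.toENNReal_le_toENNReal (EReal.neg_le_neg_iff.2 hx)

theorem expect_congr_ae {g h : α → EReal} (hgh : ∀ᵐ x ∂m, g x = h x) :
    expect m g = expect m h :=
  le_antisymm (expect_mono_ae (hgh.mono fun _ hx => hx.le))
    (expect_mono_ae (hgh.mono fun _ hx => hx.ge))

theorem coe_sub_eq_of_add_eq_add {A B p n : ℝ≥0∞} (h : A + n = B + p) (hp : p ≤ A) (hn : n ≤ B)
    (hAB : A ≠ ⊤ ∨ B ≠ ⊤) : (p : EReal) - n = (A : EReal) - B := by
  rcases hAB with hA | hB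
  · have hp' : p ≠ ⊤ := ne_top_of_le_ne_top hA hp
    lift A to ℝ≥0 using hA
    lift p to ℝ≥0 using hp'
    by_cases hB : B = ⊤
    · subst hB
      have : n = ⊤ := by
        rw [top_add] at h
        exact (ENNReal.add_eq_top.1 h).resolve_left ENNReal.coe_ne_top
      subst this
      rw [EReal.coe_ennreal_top, sub_eq_add_neg, sub_eq_add_neg, EReal.neg_top, EReal.add_bot,
        EReal.add_bot]
    · have hn' : n ≠ ⊤ := ne_top_of_le_ne_top hB hn
      lift B to ℝ≥0 using hB
      lift n to ℝ≥0 using hn'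
      have h' : (A : ℝ) + n = B + p := by exact_mod_cast h
      have : ((p : ℝ) : EReal) - ((n : ℝ) : EReal) = ((A : ℝ) : EReal) - ((B : ℝ) : EReal) := by
        rw [← EReal.coe_sub, ← EReal.coe_sub]
        congr 1
        linarith
      exact this
  · have hn' : n ≠ ⊤ := ne_top_of_le_ne_top hB hn
    lift B to ℝ≥0 using hB
    lift n to ℝ≥0 using hn'
    by_cases hA : A = ⊤
    · subst hA
      have : p = ⊤ := by
        rw [top_add] at h
        exact (ENNReal.add_eq_top.1 h.symm).resolve_left ENNReal.coe_ne_top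
      subst this
      rw [EReal.coe_ennreal_top]
      exact (EReal.top_sub_coe (n : ℝ)).trans (EReal.top_sub_coe (B : ℝ)).symm
    · have hp' : p ≠ ⊤ := ne_top_of_le_ne_top hA hp
      lift A to ℝ≥0 using hA
      lift p to ℝ≥0 using hp'
      have h' : (A : ℝ) + n = B + p := by exact_mod_cast h
      have : ((p : ℝ) : EReal) - ((n : ℝ) : EReal) = ((A : ℝ) : EReal) - ((B : ℝ) : EReal) := by
        rw [← EReal.coe_sub, ← EReal.coe_sub]
        congr 1
        linarith
      exact this

theorem toENNReal_coe_sub_coe (a b : ℝ≥0∞) : ((a : EReal) - (b : EReal)).toENNReal = a - b := by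
  rw [EReal.toENNReal_sub (EReal.coe_ennreal_nonneg b), EReal.toENNReal_coe, EReal.toENNReal_coe]

/-- The expectation of a difference of nonnegative functions, not necessarily its positive and
negative parts, is the difference of the integrals as soon as one of them is finite. -/
theorem expect_coe_sub_coe {a b : α → ℝ≥0∞} (ha : AEMeasurable a m) (hb : AEMeasurable b m)
    (hab : ∫⁻ x, a x ∂m ≠ ⊤ ∨ ∫⁻ x, b x ∂m ≠ ⊤) :
    expect m (fun x => (a x : EReal) - (b x : EReal)) =
      ((∫⁻ x, a x ∂m : ℝ≥0∞) : EReal) - ((∫⁻ x, b x ∂m : ℝ≥0∞) : EReal) := by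
  have hfin : ∀ᵐ x ∂m, a x ≠ ⊤ ∨ b x ≠ ⊤ := by
    rcases hab with h | h
    · filter_upwards [ae_lt_top' ha h] with x hx using Or.inl hx.ne
    · filter_upwards [ae_lt_top' hb h] with x hx using Or.inr hx.ne
  have hneg : ∫⁻ x, (-((a x : EReal) - (b x : EReal))).toENNReal ∂m = ∫⁻ x, (b x - a x) ∂m := by
    refine lintegral_congr_ae ?_
    filter_upwards [hfin] with x hx
    rw [EReal.neg_sub, add_comm, ← sub_eq_add_neg, toENNReal_coe_sub_coe]
    · exact Or.inl (EReal.coe_ennreal_ne_bot _)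
    · rcases hx with hx | hx
      · exact Or.inl (by simpa using hx)
      · exact Or.inr (by simpa using hx)
  unfold expect
  rw [hneg]
  simp only [toENNReal_coe_sub_coe]
  refine coe_sub_eq_of_add_eq_add ?_ (lintegral_mono fun x => tsub_le_self)
    (lintegral_mono fun x => tsub_le_self) hab
  rw [← lintegral_add_left' ha, ← lintegral_add_left' hb]
  refine lintegral_congr fun x => ?_
  rw [add_tsub_eq_max, add_tsub_eq_max, max_comm]

theorem coe_eq_coe_ofReal_sub (x : ℝ) :
    (x : EReal) = (ENNReal.ofReal x : EReal) - (ENNReal.ofReal (-x) : EReal) := by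
  rw [EReal.coe_ennreal_ofReal, EReal.coe_ennreal_ofReal, ← EReal.coe_sub]
  congr 1
  rw [max_zero_sub_eq_self]

theorem expect_coe {g : α → ℝ} (hg : Integrable g m) :
    expect m (fun x => (g x : EReal)) = ((∫ x, g x ∂m : ℝ) : EReal) := by
  have h1 : ∫⁻ x, ENNReal.ofReal (g x) ∂m ≠ ⊤ := hg.lintegral_lt_top.ne
  have h2 : ∫⁻ x, ENNReal.ofReal (-g x) ∂m ≠ ⊤ := hg.neg.lintegral_lt_top.ne
  rw [expect_congr_ae (ae_of_all _ fun x => coe_eq_coe_ofReal_sub (g x)),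
    expect_coe_sub_coe (b := fun x => ENNReal.ofReal (-g x)) hg.aemeasurable.ennreal_ofReal
      hg.neg.aemeasurable.ennreal_ofReal (Or.inl h1), integral_eq_lintegral_pos_part_sub_lintegral_neg_part hg, EReal.coe_sub]
  rw [EReal.coe_ennreal_toReal h1, EReal.coe_ennreal_toReal h2]

/-- Monotone convergence as an upper bound: nothing is required of the measurability of `V`. -/
theorem expect_le_iSup_integral {g : ℕ → α → ℝ} (hg : ∀ n, Integrable (g n) m)
    (hmono : ∀ᵐ x ∂m, Monotone fun n => g n x) {V : α → EReal}
    (hV : ∀ᵐ x ∂m, V x ≤ ⨆ n, (g n x : EReal)) :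
    expect m V ≤ ⨆ n, ((∫ x, g n x ∂m : ℝ) : EReal) := by
  set B : EReal := ⨆ n, ((∫ x, g n x ∂m : ℝ) : EReal) with hB
  have hle : ∀ n, ((∫ x, g n x ∂m : ℝ) : EReal) ≤ B :=
    fun n => le_iSup (fun n => ((∫ x, g n x ∂m : ℝ) : EReal)) n
  clear_value B
  induction B with
  | top => exact le_top
  | bot => exact absurd (hle 0) (not_le.2 (EReal.bot_lt_coe _))
  | coe b =>
    have hle' : ∀ n, ∫ x, g n x ∂m ≤ b := fun n => EReal.coe_le_coe_iff.1 (hle n)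
    have hmeas : ∀ n, AEMeasurable (fun x => ENNReal.ofReal (g n x - g 0 x)) m :=
      fun n => ((hg n).sub (hg 0)).aemeasurable.ennreal_ofReal
    have hA : ∫⁻ x, ⨆ n, ENNReal.ofReal (g n x - g 0 x) ∂m ≤
        ENNReal.ofReal (b - ∫ x, g 0 x ∂m) := by
      rw [lintegral_iSup' hmeas]
      · refine iSup_le fun n => ?_
        rw [← ofReal_integral_eq_lintegral_ofReal (f := fun x => g n x - g 0 x)
          ((hg n).sub (hg 0)), integral_sub (hg n) (hg 0)]
        · exact ENNReal.ofReal_le_ofReal (by linarith [hle' n])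
        · filter_upwards [hmono] with x hx using sub_nonneg.2 (hx (Nat.zero_le n))
      · filter_upwards [hmono] with x hx i j hij
        exact ENNReal.ofReal_le_ofReal (sub_le_sub_right (hx hij) _)
    have h1 : ∫⁻ x, ENNReal.ofReal (g 0 x) ∂m ≠ ⊤ := (hg 0).lintegral_lt_top.ne
    have h2 : ∫⁻ x, ENNReal.ofReal (-g 0 x) ∂m ≠ ⊤ := (hg 0).neg.lintegral_lt_top.ne
    have key : expect m V ≤ expect m fun x =>
        (((⨆ n, ENNReal.ofReal (g n x - g 0 x)) + ENNReal.ofReal (g 0 x) : ℝ≥0∞) : EReal) -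
          (ENNReal.ofReal (-g 0 x) : EReal) := by
      refine expect_mono_ae ?_
      filter_upwards [hV, hmono] with x hx hx'
      refine hx.trans (iSup_le fun n => ?_)
      have : (g n x : EReal) = ((ENNReal.ofReal (g n x - g 0 x) + ENNReal.ofReal (g 0 x) : ℝ≥0∞) :
          EReal) - (ENNReal.ofReal (-g 0 x) : EReal) := by
        rw [EReal.coe_ennreal_add, EReal.coe_ennreal_ofReal, EReal.coe_ennreal_ofReal,
          EReal.coe_ennreal_ofReal, ← EReal.coe_add, ← EReal.coe_sub,
          max_eq_left (sub_nonneg.2 (hx' (Nat.zero_le n)))]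
        congr 1
        have := max_zero_sub_eq_self (g 0 x)
        linarith
      rw [this]
      refine EReal.sub_le_sub (EReal.coe_ennreal_le_coe_ennreal_iff.2 ?_) le_rfl
      gcongr
      exact le_iSup (fun n => ENNReal.ofReal (g n x - g 0 x)) n
    refine key.trans ?_
    rw [expect_coe_sub_coe
      (a := fun x => (⨆ n, ENNReal.ofReal (g n x - g 0 x)) + ENNReal.ofReal (g 0 x))
      (b := fun x => ENNReal.ofReal (-g 0 x)) ((AEMeasurable.iSup hmeas).add
      (hg 0).aemeasurable.ennreal_ofReal) (hg 0).neg.aemeasurable.ennreal_ofReal (Or.inr h2),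
      lintegral_add_left' (AEMeasurable.iSup hmeas)]
    have h0 : ∫ x, g 0 x ∂m = (∫⁻ x, ENNReal.ofReal (g 0 x) ∂m).toReal -
      (∫⁻ x, ENNReal.ofReal (-g 0 x) ∂m).toReal :=
      integral_eq_lintegral_pos_part_sub_lintegral_neg_part (hg 0)
    calc _ ≤ ((ENNReal.ofReal (b - ∫ x, g 0 x ∂m) + ∫⁻ x, ENNReal.ofReal (g 0 x) ∂m : ℝ≥0∞) :
          EReal) - ((∫⁻ x, ENNReal.ofReal (-g 0 x) ∂m : ℝ≥0∞) : EReal) := by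
          refine EReal.sub_le_sub (EReal.coe_ennreal_le_coe_ennreal_iff.2 ?_) le_rfl
          gcongr
      _ = (b : EReal) := by
          rw [EReal.coe_ennreal_add, ← EReal.coe_ennreal_toReal h1,
            ← EReal.coe_ennreal_toReal h2, EReal.coe_ennreal_ofReal,
            max_eq_left (sub_nonneg.2 (hle' 0)), ← EReal.coe_add, ← EReal.coe_sub]
          congr 1
          linarith

end Expectation


/-! ### The conjugate of a divergence function -/

section Conjugate

variable {η : ℝ} {φ : ℝ → ℝ≥0∞}

theorem coe_mul_coe_of_ne_top {t : ℝ} (ht : φ t ≠ ⊤) :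
    (η : EReal) * ((φ t : ℝ≥0∞) : EReal) = ((η * (φ t).toReal : ℝ) : EReal) := by
  rw [EReal.coe_mul, EReal.coe_ennreal_toReal ht]

theorem coe_mul_coe_top (hη : 0 < η) : (η : EReal) * ((⊤ : ℝ≥0∞) : EReal) = ⊤ := by
  rw [EReal.coe_ennreal_top, EReal.coe_mul_top_of_pos hη]

theorem IsDivergenceFunction.nonneg_of_ne_top (hφ : IsDivergenceFunction φ) {t : ℝ}
    (ht : φ t ≠ ⊤) : 0 ≤ t :=
  not_lt.1 fun h => ht (hφ.map_neg t h)

theorem le_conj (s : EReal) (t : ℝ) :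
    s * (t : EReal) - (η : EReal) * ((φ t : ℝ≥0∞) : EReal) ≤ conj η φ s :=
  le_iSup (fun t : ℝ => s * (t : EReal) - (η : EReal) * ((φ t : ℝ≥0∞) : EReal)) t

theorem coe_le_conj {r t : ℝ} (ht : φ t ≠ ⊤) :
    ((r * t - η * (φ t).toReal : ℝ) : EReal) ≤ conj η φ r := by
  refine le_trans (le_of_eq ?_) (le_conj (r : EReal) t)
  rw [coe_mul_coe_of_ne_top ht, EReal.coe_sub, EReal.coe_mul]

theorem conj_le (hη : 0 < η) {s c : EReal}
    (h : ∀ t : ℝ, φ t ≠ ⊤ → s * (t : EReal) - ((η * (φ t).toReal : ℝ) : EReal) ≤ c) :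
    conj η φ s ≤ c := by
  refine iSup_le fun t => ?_
  by_cases ht : φ t = ⊤
  · rw [ht, coe_mul_coe_top hη, sub_eq_add_neg, EReal.neg_top, EReal.add_bot]
    exact bot_le
  · rw [coe_mul_coe_of_ne_top ht]
    exact h t ht

theorem conj_coe_le (hη : 0 < η) {r c : ℝ}
    (h : ∀ t : ℝ, φ t ≠ ⊤ → r * t - η * (φ t).toReal ≤ c) : conj η φ r ≤ c :=
  conj_le hη fun t ht => by
    rw [← EReal.coe_mul, ← EReal.coe_sub]
    exact EReal.coe_le_coe_iff.2 (h t ht)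

theorem IsDivergenceFunction.le_conj (hφ : IsDivergenceFunction φ) (s : EReal) :
    s ≤ conj η φ s := by
  simpa [hφ.map_one] using PhiRegDRO.le_conj (η := η) (φ := φ) s 1

theorem IsDivergenceFunction.convex_toReal (hφ : IsDivergenceFunction φ) {x y a b : ℝ}
    (hx : φ x ≠ ⊤) (hy : φ y ≠ ⊤) (ha : 0 ≤ a) (hb : 0 ≤ b) (hab : a + b = 1) :
    φ (a * x + b * y) ≠ ⊤ ∧
      (φ (a * x + b * y)).toReal ≤ a * (φ x).toReal + b * (φ y).toReal := by
  have h := hφ.convex x y a b ha hb hab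
  have h1 : ENNReal.ofReal a * φ x ≠ ⊤ := ENNReal.mul_ne_top ENNReal.ofReal_ne_top hx
  have h2 : ENNReal.ofReal b * φ y ≠ ⊤ := ENNReal.mul_ne_top ENNReal.ofReal_ne_top hy
  refine ⟨ne_top_of_le_ne_top (ENNReal.add_ne_top.2 ⟨h1, h2⟩) h, ?_⟩
  have h' := ENNReal.toReal_mono (ENNReal.add_ne_top.2 ⟨h1, h2⟩) h
  rwa [ENNReal.toReal_add h1 h2, ENNReal.toReal_mul, ENNReal.toReal_mul, ENNReal.toReal_ofReal ha,
    ENNReal.toReal_ofReal hb] at h'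

/-- The Fenchel equality: a subgradient of the conjugate at `s` attains the supremum defining the
conjugate. If it did not, the point `(ζ, (s ζ - (ηφ)^*(s)) / η)` would lie outside of the closed
convex epigraph of `φ`; a line that separates them is either a slope at which the subgradient
inequality fails, or, when it is vertical, a direction in which it fails. -/
theorem IsConjSubgradient.conj_le (hφ : IsDivergenceFunction φ) (hη : 0 < η) {s : EReal} {ζ : ℝ}
    (h : IsConjSubgradient η φ s ζ) :
    conj η φ s ≤ s * (ζ : EReal) - (η : EReal) * ((φ ζ : ℝ≥0∞) : EReal) := by
  obtain ⟨r, rfl, htop, hsub⟩ := h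
  obtain ⟨c, hc⟩ : ∃ c : ℝ, conj η φ r = c :=
    ⟨(conj η φ r).toReal, (EReal.coe_toReal htop
      (ne_bot_of_le_ne_bot (EReal.coe_ne_bot r) (hφ.le_conj _))).symm⟩
  rw [hc] at hsub ⊢
  set y₀ : ℝ := (r * ζ - c) / η with hy₀
  have hηy₀ : η * y₀ = r * ζ - c := by rw [hy₀]; field_simp
  let S : Set (ℝ × ℝ) := {p | 0 ≤ p.2 ∧ φ p.1 ≤ ENNReal.ofReal p.2}
  have hmem : ∀ {t : ℝ}, φ t ≠ ⊤ → (t, (φ t).toReal) ∈ S := fun {t} ht =>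
    ⟨ENNReal.toReal_nonneg, by simp [ENNReal.ofReal_toReal ht]⟩
  by_cases hS : (ζ, y₀) ∈ S
  · have hζ : φ ζ ≠ ⊤ := ne_top_of_le_ne_top ENNReal.ofReal_ne_top hS.2
    have hle : (φ ζ).toReal ≤ y₀ := ENNReal.toReal_le_of_le_ofReal hS.1 hS.2
    rw [coe_mul_coe_of_ne_top hζ, ← EReal.coe_mul, ← EReal.coe_sub, EReal.coe_le_coe_iff]
    nlinarith
  · exfalso
    have hclosed : IsClosed S :=
      (isClosed_le continuous_const continuous_snd).inter
        (hφ.lowerSemicontinuous.isClosed_epigraph.preimage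
          (continuous_fst.prodMk (ENNReal.continuous_ofReal.comp continuous_snd)))
    have hconvex : Convex ℝ S := by
      rintro ⟨t, y⟩ ⟨hy, ht⟩ ⟨t', y'⟩ ⟨hy', ht'⟩ a b ha hb hab
      simp only at hy ht hy' ht'
      have ht1 : φ t ≠ ⊤ := ne_top_of_le_ne_top ENNReal.ofReal_ne_top ht
      have ht2 : φ t' ≠ ⊤ := ne_top_of_le_ne_top ENNReal.ofReal_ne_top ht'
      obtain ⟨h1, h2⟩ := hφ.convex_toReal ht1 ht2 ha hb hab
      refine ⟨by simp only [Prod.smul_mk, Prod.mk_add_mk, smul_eq_mul]; positivity, ?_⟩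
      simp only [Prod.smul_mk, Prod.mk_add_mk, smul_eq_mul]
      rw [← ENNReal.ofReal_toReal h1]
      refine ENNReal.ofReal_le_ofReal (h2.trans ?_)
      gcongr
      · exact ENNReal.toReal_le_of_le_ofReal hy ht
      · exact ENNReal.toReal_le_of_le_ofReal hy' ht'
    obtain ⟨g, u, hg, hu⟩ := geometric_hahn_banach_point_closed hconvex hclosed hS
    set α := g (1, 0) with hα
    set β := g (0, 1) with hβ
    have hglin : ∀ t y : ℝ, g (t, y) = t * α + y * β := fun t y => by
      have : (t, y) = t • ((1 : ℝ), (0 : ℝ)) + y • ((0 : ℝ), (1 : ℝ)) := by simp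
      rw [this, map_add, map_smul, map_smul, smul_eq_mul, smul_eq_mul]
    rw [hglin] at hg
    have hβ0 : 0 ≤ β := by
      by_contra hneg
      have hpos : 0 < -β := by linarith
      have := hu (1, (|α| + |u|) / (-β)) ⟨by positivity, by simp [hφ.map_one]⟩
      rw [hglin] at this
      have h1 : (|α| + |u|) / (-β) * β = -(|α| + |u|) := by
        rw [div_neg, neg_mul, div_mul_cancel₀ _ (by linarith : β < 0).ne]
      linarith [le_abs_self α, neg_abs_le u]
    have hdom : ∀ {t : ℝ}, φ t ≠ ⊤ → u < t * α + (φ t).toReal * β := fun {t} ht => by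
      rw [← hglin]
      exact hu _ (hmem ht)
    have hfen : ∀ {t : ℝ}, φ t ≠ ⊤ → r * t - η * (φ t).toReal ≤ c := fun {t} ht => by
      have := coe_le_conj (η := η) (r := r) ht
      rw [hc] at this
      exact EReal.coe_le_coe_iff.1 this
    rcases hβ0.lt_or_eq with hβpos | hβzero
    · have hcle : conj η φ ((-(η * α / β) : ℝ) : EReal) ≤ ((-(η * u / β) : ℝ) : EReal) :=
        conj_coe_le hη fun t ht => by
          have := hdom ht
          have e : -(η * u / β) - (-(η * α / β) * t - η * (φ t).toReal) =
            η / β * (t * α + (φ t).toReal * β - u) := by field_simp; ring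
          have : 0 ≤ η / β * (t * α + (φ t).toReal * β - u) :=
            mul_nonneg (by positivity) (by linarith)
          linarith
      have := (hsub (-(η * α / β))).trans hcle
      rw [← EReal.coe_add, EReal.coe_le_coe_iff] at this
      have e : c + ζ * (-(η * α / β) - r) + η * u / β = η / β * (u - (ζ * α + y₀ * β)) := by
        have : c = r * ζ - η * y₀ := by linarith
        rw [this]; field_simp; ring
      have : 0 < η / β * (u - (ζ * α + y₀ * β)) := mul_pos (by positivity) (by linarith)
      linarith
    · have hcle : conj η φ ((r - α : ℝ) : EReal) ≤ ((c - u : ℝ) : EReal) :=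
        conj_coe_le hη fun t ht => by
          have h1 := hdom ht
          have h2 := hfen ht
          rw [← hβzero] at h1
          linarith
      have := (hsub (r - α)).trans hcle
      rw [← EReal.coe_add, EReal.coe_le_coe_iff] at this
      rw [← hβzero] at hg
      linarith

/-- The pointwise gain `(s - μ) t - η φ(t)` as a difference of two nonnegative numbers, arranged
so that the terms that involve `μ` integrate to `μ` when `t` is a probability density. -/
theorem coe_sub_coe_eq_gain (hη : 0 < η) {s : EReal} (hs : s ≠ ⊥) {t : ℝ} (ht : 0 ≤ t) (μ : ℝ) :
    ((s.toENNReal * ENNReal.ofReal t + ENNReal.ofReal (-μ) * ENNReal.ofReal t : ℝ≥0∞) : EReal) -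
      (((-s).toENNReal * ENNReal.ofReal t + ENNReal.ofReal η * φ t +
        ENNReal.ofReal μ * ENNReal.ofReal t : ℝ≥0∞) : EReal) =
      (s - (μ : EReal)) * (t : EReal) - (η : EReal) * ((φ t : ℝ≥0∞) : EReal) := by
  by_cases hφt : φ t = ⊤
  · rw [hφt, coe_mul_coe_top hη, ENNReal.mul_top (by simpa using hη), add_top, top_add,
      EReal.coe_ennreal_top, sub_eq_add_neg, sub_eq_add_neg, EReal.neg_top, EReal.add_bot,
      EReal.add_bot]
  have e1 : ENNReal.ofReal η * φ t = ENNReal.ofReal (η * (φ t).toReal) := by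
    rw [ENNReal.ofReal_mul hη.le, ENNReal.ofReal_toReal hφt]
  have hpos : 0 ≤ η * (φ t).toReal := mul_nonneg hη.le ENNReal.toReal_nonneg
  rw [e1, coe_mul_coe_of_ne_top hφt]
  set y := η * (φ t).toReal with hy
  clear_value y
  have hμ := max_zero_sub_eq_self μ
  rcases ht.eq_or_lt with rfl | htpos
  · simp [max_eq_left hpos]
  induction s with
  | bot => exact absurd rfl hs
  | top =>
    have h1 : (⊤ : ℝ≥0∞) * ENNReal.ofReal t = ⊤ := ENNReal.top_mul (by simpa using htpos)
    have h2 : (⊤ : EReal) - (μ : EReal) = ⊤ := EReal.top_sub_coe μ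
    rw [h2, EReal.top_mul_coe_of_pos htpos, EReal.top_sub_coe, EReal.toENNReal_top, h1, top_add,
      EReal.neg_top, EReal.toENNReal_bot, zero_mul, zero_add, ← ENNReal.ofReal_mul' ht,
      EReal.coe_ennreal_top, EReal.coe_ennreal_add, EReal.coe_ennreal_ofReal,
      EReal.coe_ennreal_ofReal, ← EReal.coe_add, EReal.top_sub_coe]
  | coe x =>
    have hx := max_zero_sub_eq_self x
    rw [← EReal.coe_neg, EReal.real_coe_toENNReal, EReal.real_coe_toENNReal,
      EReal.coe_ennreal_add, EReal.coe_ennreal_add, EReal.coe_ennreal_add, EReal.coe_ennreal_mul,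
      EReal.coe_ennreal_mul, EReal.coe_ennreal_mul, EReal.coe_ennreal_mul]
    simp only [EReal.coe_ennreal_ofReal, max_eq_left ht, max_eq_left hpos, ← EReal.coe_add,
      ← EReal.coe_mul, ← EReal.coe_sub]
    congr 1
    linear_combination t * hx - t * hμ

end Conjugate


/-! ### Admissible densities -/

section Admissible

variable {X : Type*} [MeasurableSpace X] {F : X → EReal} {φ : ℝ → ℝ≥0∞} {η : ℝ} {γ : Measure X}

/-- `ζ` is a nonnegative function, not yet normalized, at which the primal objective is not of the
form `∞ - ∞`, and the real valued integrable function `h` is a lower bound of the gain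
`F ζ - η φ(ζ)`. Only a real number `r ≤ F x` enters this bound, so that the value `∞` of `F` has no
special role. -/
structure Admissible (F : X → EReal) (φ : ℝ → ℝ≥0∞) (η : ℝ) (γ : Measure X) (ζ h : X → ℝ) :
    Prop where
  measurable : Measurable ζ
  measurable_gain : Measurable h
  nonneg : ∀ x, 0 ≤ ζ x
  integrable : Integrable ζ γ
  integrable_gain : Integrable h γ
  lintegral_neg : ∫⁻ x, (-F x).toENNReal * ENNReal.ofReal (ζ x) ∂γ < ⊤
  lintegral_div : ∫⁻ x, φ (ζ x) ∂γ < ⊤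
  ne_top : ∀ x, φ (ζ x) ≠ ⊤
  gain_le : ∀ x, ∃ r : ℝ, (r : EReal) ≤ F x ∧ h x ≤ r * ζ x - η * (φ (ζ x)).toReal

/-- The first index at which the largest of the numbers `s 0, …, s n` is found. -/
noncomputable def argmaxUpTo (s : ℕ → ℝ) : ℕ → ℕ
  | 0 => 0
  | n + 1 => if s (argmaxUpTo s n) < s (n + 1) then n + 1 else argmaxUpTo s n

theorem argmaxUpTo_le (s : ℕ → ℝ) (n : ℕ) : argmaxUpTo s n ≤ n := by
  induction n with
  | zero => exact le_rfl
  | succ n ih =>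
    rw [argmaxUpTo]
    split_ifs
    · exact le_rfl
    · exact ih.trans n.le_succ

theorem monotone_apply_argmaxUpTo (s : ℕ → ℝ) : Monotone fun n => s (argmaxUpTo s n) := by
  refine monotone_nat_of_le_succ fun n => ?_
  simp only [argmaxUpTo]
  split_ifs with h
  · exact h.le
  · exact le_rfl

theorem le_apply_argmaxUpTo (s : ℕ → ℝ) (n : ℕ) : s n ≤ s (argmaxUpTo s n) := by
  cases n with
  | zero => exact le_rfl
  | succ n =>
    simp only [argmaxUpTo]
    split_ifs with h
    · exact le_rfl
    · exact not_lt.1 h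

theorem measurable_apply_index {s : ℕ → X → ℝ} (hs : ∀ i, Measurable (s i)) {k : X → ℕ}
    (hk : Measurable k) : Measurable fun x => s (k x) x :=
  (measurable_from_prod_countable_right (f := fun p : ℕ × X => s p.1 p.2) hs).comp
    (hk.prodMk measurable_id)

theorem measurable_argmaxUpTo {s : ℕ → X → ℝ} (hs : ∀ i, Measurable (s i)) (n : ℕ) :
    Measurable fun x => argmaxUpTo (fun i => s i x) n := by
  induction n with
  | zero => exact measurable_const
  | succ n ih =>
    simp only [argmaxUpTo]
    exact Measurable.ite (measurableSet_lt (measurable_apply_index hs ih) (hs (n + 1)))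
      measurable_const ih

theorem Admissible.select (hφ : IsDivergenceFunction φ) (hF : Measurable F) {ζ h : ℕ → X → ℝ}
    (H : ∀ i, Admissible F φ η γ (ζ i) (h i)) {k : X → ℕ} (hk : Measurable k) {n : ℕ}
    (hkn : ∀ x, k x ≤ n) :
    Admissible F φ η γ (fun x => ζ (k x) x) (fun x => h (k x) x) := by
  have hmem : ∀ x, k x ∈ Finset.range (n + 1) := fun x =>
    Finset.mem_range.2 (Nat.lt_succ_of_le (hkn x))
  have hint : ∀ u : ℕ → X → ℝ, (∀ i, Measurable (u i)) → (∀ i, Integrable (u i) γ) →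
      Integrable (fun x => u (k x) x) γ := fun u hu hui => by
    refine Integrable.mono' (integrable_finsetSum (Finset.range (n + 1)) fun i _ => (hui i).norm)
      (measurable_apply_index hu hk).aestronglyMeasurable (ae_of_all _ fun x => ?_)
    exact Finset.single_le_sum (f := fun i => ‖u i x‖) (fun i _ => norm_nonneg _) (hmem x)
  have hlint : ∀ u : ℕ → X → ℝ≥0∞, (∀ i, Measurable (u i)) → (∀ i, ∫⁻ x, u i x ∂γ < ⊤) →
      ∫⁻ x, u (k x) x ∂γ < ⊤ := fun u hu hui => by
    refine lt_of_le_of_lt (lintegral_mono fun x => Finset.single_le_sum (f := fun i => u i x)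
      (fun i _ => bot_le) (hmem x)) ?_
    rw [lintegral_finsetSum _ fun i _ => hu i]
    exact ENNReal.sum_lt_top.2 fun i _ => hui i
  exact
    { measurable := measurable_apply_index (fun i => (H i).measurable) hk
      measurable_gain := measurable_apply_index (fun i => (H i).measurable_gain) hk
      nonneg := fun x => (H _).nonneg x
      integrable := hint ζ (fun i => (H i).measurable) fun i => (H i).integrable
      integrable_gain := hint h (fun i => (H i).measurable_gain) fun i => (H i).integrable_gain
      lintegral_neg := hlint (fun i x => (-F x).toENNReal * ENNReal.ofReal (ζ i x))
        (fun i => (measurable_ereal_toENNReal.comp hF.neg).mul (H i).measurable.ennreal_ofReal)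
        fun i => (H i).lintegral_neg
      lintegral_div := hlint (fun i x => φ (ζ i x))
        (fun i => hφ.lowerSemicontinuous.measurable.comp (H i).measurable)
        fun i => (H i).lintegral_div
      ne_top := fun x => (H _).ne_top x
      gain_le := fun x => (H _).gain_le x }

/-- Admissible densities may be mixed with weights that depend on the point: the gain is
concave in the density. -/
theorem Admissible.mix (hφ : IsDivergenceFunction φ) (hF : Measurable F) (hη : 0 < η)
    {ζ h ζ' h' w : X → ℝ} (H : Admissible F φ η γ ζ h) (H' : Admissible F φ η γ ζ' h')
    (hw : Measurable w) (hw0 : ∀ x, 0 ≤ w x) (hw1 : ∀ x, w x ≤ 1) :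
    Admissible F φ η γ (fun x => w x * ζ x + (1 - w x) * ζ' x)
      (fun x => w x * h x + (1 - w x) * h' x) := by
  have hw' : ∀ x, 0 ≤ 1 - w x := fun x => sub_nonneg.2 (hw1 x)
  have hnorm : ∀ x, ‖w x‖ ≤ 1 := fun x => by
    rw [Real.norm_eq_abs, abs_le]
    constructor <;> linarith [hw0 x, hw1 x]
  have hnorm' : ∀ x, ‖1 - w x‖ ≤ 1 := fun x => by
    rw [Real.norm_eq_abs, abs_le]
    constructor <;> linarith [hw0 x, hw1 x]
  have hint : ∀ {u v : X → ℝ}, Integrable u γ → Integrable v γ →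
      Integrable (fun x => w x * u x + (1 - w x) * v x) γ := fun {u v} hu hv =>
    (hu.bdd_mul hw.aestronglyMeasurable (ae_of_all _ hnorm)).add
      (hv.bdd_mul (measurable_const.sub hw).aestronglyMeasurable (ae_of_all _ hnorm'))
  have hζ : Measurable fun x => w x * ζ x + (1 - w x) * ζ' x :=
    (hw.mul H.measurable).add ((measurable_const.sub hw).mul H'.measurable)
  have hFm : Measurable fun x => (-F x).toENNReal := measurable_ereal_toENNReal.comp hF.neg
  refine
    { measurable := hζ
      measurable_gain :=
        (hw.mul H.measurable_gain).add ((measurable_const.sub hw).mul H'.measurable_gain)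
      nonneg := fun x => add_nonneg (mul_nonneg (hw0 x) (H.nonneg x))
        (mul_nonneg (hw' x) (H'.nonneg x))
      integrable := hint H.integrable H'.integrable
      integrable_gain := hint H.integrable_gain H'.integrable_gain
      lintegral_neg := ?_
      lintegral_div := ?_
      ne_top := fun x => (hφ.convex_toReal (H.ne_top x) (H'.ne_top x) (hw0 x) (hw' x)
        (by ring)).1
      gain_le := fun x => ?_ }
  · refine lt_of_le_of_lt (lintegral_mono (g := fun x => (-F x).toENNReal * ENNReal.ofReal (ζ x) +
      (-F x).toENNReal * ENNReal.ofReal (ζ' x)) fun x => ?_) ?_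
    · simp only
      rw [← mul_add, ← ENNReal.ofReal_add (H.nonneg x) (H'.nonneg x)]
      gcongr
      · exact mul_le_of_le_one_left (H.nonneg x) (hw1 x)
      · exact mul_le_of_le_one_left (H'.nonneg x) (by linarith [hw0 x])
    · rw [lintegral_add_left (f := fun x => (-F x).toENNReal * ENNReal.ofReal (ζ x))
        (hFm.mul H.measurable.ennreal_ofReal)]
      exact ENNReal.add_lt_top.2 ⟨H.lintegral_neg, H'.lintegral_neg⟩
  · refine lt_of_le_of_lt (lintegral_mono (g := fun x => φ (ζ x) + φ (ζ' x)) fun x => ?_) ?_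
    · refine (hφ.convex _ _ _ _ (hw0 x) (hw' x) (by ring)).trans ?_
      exact add_le_add (mul_le_of_le_one_left' (ENNReal.ofReal_le_one.2 (hw1 x)))
        (mul_le_of_le_one_left' (ENNReal.ofReal_le_one.2 (by linarith [hw0 x])))
    · rw [lintegral_add_left (f := fun x => φ (ζ x))
        (hφ.lowerSemicontinuous.measurable.comp H.measurable)]
      exact ENNReal.add_lt_top.2 ⟨H.lintegral_div, H'.lintegral_div⟩
  · obtain ⟨r, hr, hh⟩ := H.gain_le x
    obtain ⟨r', hr', hh'⟩ := H'.gain_le x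
    refine ⟨max r r', by rcases max_choice r r' with h | h <;> rw [h] <;> assumption, ?_⟩
    have hc := (hφ.convex_toReal (H.ne_top x) (H'.ne_top x) (hw0 x) (hw' x) (by ring)).2
    have h1 : r * ζ x ≤ max r r' * ζ x := mul_le_mul_of_nonneg_right (le_max_left _ _) (H.nonneg x)
    have h2 : r' * ζ' x ≤ max r r' * ζ' x :=
      mul_le_mul_of_nonneg_right (le_max_right _ _) (H'.nonneg x)
    have h3 := mul_le_mul_of_nonneg_left (hh.trans (sub_le_sub_right h1 _)) (hw0 x)
    have h4 := mul_le_mul_of_nonneg_left (hh'.trans (sub_le_sub_right h2 _)) (hw' x)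
    have h5 := mul_le_mul_of_nonneg_left hc hη.le
    linear_combination h3 + h4 + h5

open scoped Classical in
/-- The density that is constantly `t` where `F ≥ -n` and `ζ` elsewhere. -/
noncomputable def overwrite (F : X → EReal) (t : ℝ) (n : ℕ) (ζ : X → ℝ) (x : X) : ℝ :=
  if ((-(n : ℝ) : ℝ) : EReal) ≤ F x then t else ζ x

open scoped Classical in
/-- A bounded lower bound of the gain of `overwrite F t n ζ`, with `F` replaced by its truncation
`min F N` where the density is `t`. -/
noncomputable def overwriteGain (F : X → EReal) (φ : ℝ → ℝ≥0∞) (η t : ℝ) (n N : ℕ) (h : X → ℝ) (x : X) : ℝ :=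
  if ((-(n : ℝ) : ℝ) : EReal) ≤ F x then
    (min (F x) ((N : ℝ) : EReal)).toReal * t - η * (φ t).toReal
  else h x

theorem coe_toReal_min_of_le {s : EReal} {n N : ℕ} (h : ((-(n : ℝ) : ℝ) : EReal) ≤ s) :
    ((min s ((N : ℝ) : EReal)).toReal : EReal) = min s ((N : ℝ) : EReal) := by
  have hn : (0 : ℝ) ≤ n := Nat.cast_nonneg n
  have hN : (0 : ℝ) ≤ N := Nat.cast_nonneg N
  refine EReal.coe_toReal ?_ ?_
  · exact ne_top_of_le_ne_top (EReal.coe_ne_top _) (min_le_right _ _)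
  · exact ne_bot_of_le_ne_bot (EReal.coe_ne_bot (-(n : ℝ)))
      (le_min h (EReal.coe_le_coe_iff.2 (by linarith)))

theorem Admissible.overwrite [IsFiniteMeasure γ] (hφ : IsDivergenceFunction φ) (hF : Measurable F)
    {ζ h : X → ℝ} (H : Admissible F φ η γ ζ h) {t : ℝ} (ht : φ t ≠ ⊤) (n N : ℕ) :
    Admissible F φ η γ (overwrite F t n ζ) (overwriteGain F φ η t n N h) := by
  have hS : MeasurableSet {x | ((-(n : ℝ) : ℝ) : EReal) ≤ F x} :=
    measurableSet_le measurable_const hF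
  have ht0 := hφ.nonneg_of_ne_top ht
  have hm : Measurable (PhiRegDRO.overwrite F t n ζ) :=
    Measurable.ite hS measurable_const H.measurable
  have hmg : Measurable (overwriteGain F φ η t n N h) :=
    Measurable.ite hS (((hF.min measurable_const).ereal_toReal.mul_const t).sub_const _)
      H.measurable_gain
  have hFm : Measurable fun x => (-F x).toENNReal := measurable_ereal_toENNReal.comp hF.neg
  refine
    { measurable := hm
      measurable_gain := hmg
      nonneg := fun x => ?_
      integrable := ?_
      integrable_gain := ?_
      lintegral_neg := ?_
      lintegral_div := ?_
      ne_top := fun x => ?_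
      gain_le := fun x => ?_ }
  · unfold PhiRegDRO.overwrite
    split_ifs
    · exact ht0
    · exact H.nonneg x
  · refine Integrable.mono' ((integrable_const t).add H.integrable) hm.aestronglyMeasurable
      (ae_of_all _ fun x => ?_)
    have := H.nonneg x
    simp only [PhiRegDRO.overwrite, Real.norm_eq_abs, Pi.add_apply]
    split_ifs
    · rw [abs_of_nonneg ht0]; linarith
    · rw [abs_of_nonneg this]; linarith
  · refine Integrable.mono' ((integrable_const (((n : ℝ) + N) * t + |η * (φ t).toReal|)).add
      H.integrable_gain.norm) hmg.aestronglyMeasurable (ae_of_all _ fun x => ?_)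
    simp only [overwriteGain, Real.norm_eq_abs, Pi.add_apply]
    split_ifs with hx
    · have h1 := coe_toReal_min_of_le (N := N) hx
      have hn : (0 : ℝ) ≤ n := Nat.cast_nonneg n
      have hN : (0 : ℝ) ≤ N := Nat.cast_nonneg N
      have h2 : (min (F x) ((N : ℝ) : EReal)).toReal ≤ N :=
        EReal.coe_le_coe_iff.1 (h1.le.trans (min_le_right _ _))
      have h3 : -(n : ℝ) ≤ (min (F x) ((N : ℝ) : EReal)).toReal :=
        EReal.coe_le_coe_iff.1 ((le_min hx (EReal.coe_le_coe_iff.2 (by linarith))).trans h1.ge)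
      have h4 : |(min (F x) ((N : ℝ) : EReal)).toReal| ≤ n + N :=
        abs_le.2 ⟨by linarith, by linarith⟩
      calc _ ≤ |(min (F x) ((N : ℝ) : EReal)).toReal * t| + |η * (φ t).toReal| := abs_sub _ _
        _ ≤ (n + N) * t + |η * (φ t).toReal| := by
          rw [abs_mul, abs_of_nonneg ht0]
          gcongr
        _ ≤ _ := le_add_of_nonneg_right (abs_nonneg _)
    · have : 0 ≤ ((n : ℝ) + N) * t + |η * (φ t).toReal| := by positivity
      linarith
  · refine lt_of_le_of_lt (lintegral_mono (g := fun x => ENNReal.ofReal n * ENNReal.ofReal t +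
      (-F x).toENNReal * ENNReal.ofReal (ζ x)) fun x => ?_) ?_
    · simp only [PhiRegDRO.overwrite]
      split_ifs with hx
      · refine le_add_right ?_
        gcongr
        rw [← EReal.real_coe_toENNReal]
        refine EReal.toENNReal_le_toENNReal ?_
        rw [← neg_neg ((n : ℝ) : EReal), EReal.neg_le_neg_iff]
        exact hx
      · exact le_add_left le_rfl
    · rw [lintegral_add_left measurable_const, lintegral_const]
      exact ENNReal.add_lt_top.2 ⟨ENNReal.mul_lt_top (ENNReal.mul_lt_top ENNReal.ofReal_lt_top
        ENNReal.ofReal_lt_top) (measure_lt_top _ _), H.lintegral_neg⟩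
  · refine lt_of_le_of_lt (lintegral_mono (g := fun x => φ t + φ (ζ x)) fun x => ?_) ?_
    · simp only [PhiRegDRO.overwrite]
      split_ifs with hx
      · exact le_add_right le_rfl
      · exact le_add_left le_rfl
    · rw [lintegral_add_left measurable_const, lintegral_const]
      exact ENNReal.add_lt_top.2 ⟨ENNReal.mul_lt_top ht.lt_top (measure_lt_top _ _),
        H.lintegral_div⟩
  · unfold PhiRegDRO.overwrite
    split_ifs
    · exact ht
    · exact H.ne_top x
  · unfold PhiRegDRO.overwrite overwriteGain
    split_ifs with hx
    · exact ⟨_, (coe_toReal_min_of_le hx).le.trans (min_le_left _ _), le_rfl⟩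
    · exact H.gain_le x

end Admissible


/-! ### Duality on one fibre -/

/-- One-dimensional duality for a set of points `(m a, J a)` in the plane with points on both
sides of `m = 1`: if every line that lies above the set is above `c` at `1`, so is some chord. -/
theorem exists_chord_gt {I : Type*} {m J : I → ℝ} {c : ℝ} (hlt : ∃ a, m a < 1)
    (hgt : ∃ b, 1 < m b) (h : ∀ μ : ℝ, ∃ a, c < J a + μ * (1 - m a)) :
    ∃ a b, m a ≤ 1 ∧ 1 < m b ∧
      c < (m b - 1) / (m b - m a) * J a + (1 - (m b - 1) / (m b - m a)) * J b := by
  by_contra! hcon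
  have hcross : ∀ a b, m a ≤ 1 → 1 < m b →
      (m b - 1) * (J a - c) + (1 - m a) * (J b - c) ≤ 0 := fun a b ha hb => by
    have hpos : 0 < m b - m a := by linarith
    have h1 := hcon a b ha hb
    have h2 : (m b - 1) / (m b - m a) * J a + (1 - (m b - 1) / (m b - m a)) * J b - c =
        ((m b - 1) * (J a - c) + (1 - m a) * (J b - c)) / (m b - m a) := by
      field_simp
      ring
    have h3 : ((m b - 1) * (J a - c) + (1 - m a) * (J b - c)) / (m b - m a) ≤ 0 := by linarith
    rw [div_le_iff₀ hpos, zero_mul] at h3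
    exact h3
  obtain ⟨a₀, ha₀⟩ := hlt
  obtain ⟨b₀, hb₀⟩ := hgt
  -- The steepest slope from `(1, c)` to a point on the right.
  let S : Set ℝ := (fun b => (J b - c) / (m b - 1)) '' {b | 1 < m b}
  have hub : ∀ a, m a < 1 → ∀ s ∈ S, s ≤ (c - J a) / (1 - m a) := by
    rintro a ha _ ⟨b, hb, rfl⟩
    have hb' : 1 < m b := hb
    simp only
    rw [div_le_div_iff₀ (by linarith) (by linarith)]
    linarith [hcross a b ha.le hb']
  have hne : S.Nonempty := ⟨_, b₀, hb₀, rfl⟩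
  obtain ⟨a, ha⟩ := h (sSup S)
  rcases lt_trichotomy (m a) 1 with hlt | heq | hgt
  · have h1 : sSup S ≤ (c - J a) / (1 - m a) := csSup_le hne (hub a hlt)
    rw [le_div_iff₀ (by linarith)] at h1
    linarith
  · have h1 := hcross a b₀ heq.le hb₀
    rw [heq] at h1 ha
    nlinarith
  · have h1 : (J a - c) / (m a - 1) ≤ sSup S := le_csSup ⟨_, hub a₀ ha₀⟩ ⟨a, hgt, rfl⟩
    rw [div_le_iff₀ (by linarith)] at h1
    linarith

/-- The dual problem on one fibre: `inf_μ (μ + E_ν[(ηφ)^*(f - μ)])`. -/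
noncomputable def fibreDual {Ω : Type*} [MeasurableSpace Ω] (ν : Measure Ω) (φ : ℝ → ℝ≥0∞)
    (η : ℝ) (f : Ω → EReal) : EReal :=
  ⨅ μ : ℝ, ((μ : EReal) + expect ν fun ω => conj η φ (f ω - (μ : EReal)))

/-- A sequence in the effective domain of `φ` along which the graph of `φ` is dense. -/
theorem IsDivergenceFunction.exists_dense_seq {φ : ℝ → ℝ≥0∞} (hφ : IsDivergenceFunction φ) :
    ∃ d : ℕ → ℝ, (∀ i, φ (d i) ≠ ⊤) ∧ ∀ t, φ t ≠ ⊤ → ∀ ε > 0,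
      ∃ i, |d i - t| < ε ∧ |(φ (d i)).toReal - (φ t).toReal| < ε := by
  let G : Set (ℝ × ℝ) := {p | φ p.1 ≠ ⊤ ∧ (φ p.1).toReal = p.2}
  have : Nonempty G := ⟨⟨(1, 0), by simp [G, hφ.map_one]⟩⟩
  refine ⟨fun i => (TopologicalSpace.denseSeq G i).1.1,
    fun i => (TopologicalSpace.denseSeq G i).2.1, fun t ht ε hε => ?_⟩
  obtain ⟨i, hi⟩ := (TopologicalSpace.denseRange_denseSeq G).exists_dist_lt
    ⟨(t, (φ t).toReal), ht, rfl⟩ hε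
  refine ⟨i, ?_⟩
  rw [Subtype.dist_eq, Prod.dist_eq, max_lt_iff] at hi
  rw [(TopologicalSpace.denseSeq G i).2.2]
  rw [Real.dist_eq, Real.dist_eq, abs_sub_comm, abs_sub_comm (φ t).toReal] at hi
  exact hi

theorem conj_sub_le_iSup_overwrite {X : Type*} {F : X → EReal} {φ : ℝ → ℝ≥0∞} {η : ℝ}
    (hφ : IsDivergenceFunction φ) (hη : 0 < η) {d : ℕ → ℝ}
    (hdense : ∀ t, φ t ≠ ⊤ → ∀ ε > 0,
      ∃ i, |d i - t| < ε ∧ |(φ (d i)).toReal - (φ t).toReal| < ε)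
    (ζ h : X → ℝ) (q : ℝ) {x : X} (hx : F x ≠ ⊥) :
    conj η φ (F x - (q : EReal)) ≤ ⨆ k : ℕ × ℕ × ℕ,
      ((overwriteGain F φ η (d k.1) k.2.1 k.2.2 h x - q * overwrite F (d k.1) k.2.1 ζ x : ℝ) :
        EReal) := by
  have hval : ∀ (i n N : ℕ), ((-(n : ℝ) : ℝ) : EReal) ≤ F x →
      (((min (F x) ((N : ℝ) : EReal)).toReal * d i - η * (φ (d i)).toReal - q * d i : ℝ) :
        EReal) ≤ ⨆ k : ℕ × ℕ × ℕ, ((overwriteGain F φ η (d k.1) k.2.1 k.2.2 h x -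
          q * overwrite F (d k.1) k.2.1 ζ x : ℝ) : EReal) := fun i n N hn => by
    refine le_iSup_of_le (i, n, N) (le_of_eq ?_)
    simp only [overwriteGain, overwrite, if_pos hn]
  induction hFx : F x with
  | bot => exact absurd hFx hx
  | top =>
    refine le_top.trans (top_le_iff.2 ?_)
    obtain ⟨i, hi, -⟩ := hdense 1 (by simp [hφ.map_one]) (1 / 2) (by norm_num)
    have hi' : 1 / 2 < d i := by linarith [(abs_lt.1 hi).1]
    refine EReal.eq_top_iff_forall_lt _ |>.2 fun y => ?_
    obtain ⟨N, hN⟩ := exists_nat_gt ((y + η * (φ (d i)).toReal + q * d i) / d i)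
    rw [div_lt_iff₀ (by linarith)] at hN
    refine lt_of_lt_of_le ?_ (hval i 0 N (by rw [hFx]; exact le_top))
    rw [hFx, min_eq_right le_top, EReal.toReal_coe, EReal.coe_lt_coe_iff]
    linarith
  | coe r =>
    obtain ⟨n, hn⟩ := exists_nat_ge (-r)
    obtain ⟨N, hN⟩ := exists_nat_ge r
    have hn' : ((-(n : ℝ) : ℝ) : EReal) ≤ F x := by
      rw [hFx]; exact EReal.coe_le_coe_iff.2 (by linarith)
    rw [← EReal.coe_sub]
    refine conj_le hη fun t ht => ?_
    rw [← EReal.coe_mul, ← EReal.coe_sub]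
    by_contra! hcon
    obtain ⟨y, hy, hyt⟩ := EReal.lt_iff_exists_real_btwn.1 hcon
    rw [EReal.coe_lt_coe_iff] at hyt
    refine hyt.not_ge ?_
    refine le_of_forall_pos_le_add fun ε hε => ?_
    set C := |r - q| + η with hC
    have hCpos : 0 < C := by positivity
    obtain ⟨i, hi, hi'⟩ := hdense t ht (ε / C) (by positivity)
    have h1 := (hval i n N hn').trans hy.le
    rw [hFx, min_eq_left (EReal.coe_le_coe_iff.2 hN), EReal.toReal_coe, EReal.coe_le_coe_iff] at h1
    have h2 : (r - q) * (t - d i) ≤ |r - q| * (ε / C) := by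
      refine (le_abs_self _).trans ?_
      rw [abs_mul, abs_sub_comm t]
      gcongr
    have h3 : η * ((φ (d i)).toReal - (φ t).toReal) ≤ η * (ε / C) := by
      gcongr
      exact (le_abs_self _).trans hi'.le
    have h4 : |r - q| * (ε / C) + η * (ε / C) = ε := by rw [← add_mul, ← hC]; field_simp
    linarith

section Fibre

variable {Ω : Type*} [MeasurableSpace Ω] {ν : Measure Ω} {φ : ℝ → ℝ≥0∞} {η : ℝ} {f : Ω → EReal}

/-- The index at which the score `s.1 h_i + s.2 ζ_i` is largest among the first `n + 1` members of
the family `(ζ_i, h_i)`. -/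
noncomputable def bestIndex {X : Type*} (ζ h : ℕ → X → ℝ) (s : ℚ × ℚ) (n : ℕ) (x : X) : ℕ :=
  argmaxUpTo (fun i => s.1 * h i x + s.2 * ζ i x) n

theorem expect_le_iSup_bestIndex {ζ h : ℕ → Ω → ℝ} (s : ℚ × ℚ)
    (hζ : ∀ n, Integrable (fun ω => ζ (bestIndex ζ h s n ω) ω) ν)
    (hh : ∀ n, Integrable (fun ω => h (bestIndex ζ h s n ω) ω) ν) {V : Ω → EReal}
    (hV : ∀ ω, V ω ≤ ⨆ i, ((s.1 * h i ω + s.2 * ζ i ω : ℝ) : EReal)) :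
    expect ν V ≤ ⨆ n, ((s.1 * ∫ ω, h (bestIndex ζ h s n ω) ω ∂ν +
      s.2 * ∫ ω, ζ (bestIndex ζ h s n ω) ω ∂ν : ℝ) : EReal) := by
  have key := expect_le_iSup_integral (m := ν) (V := V)
    (g := fun n ω => s.1 * h (bestIndex ζ h s n ω) ω + s.2 * ζ (bestIndex ζ h s n ω) ω)
    (fun n => ((hh n).const_mul _).add ((hζ n).const_mul _))
    (ae_of_all _ fun ω => monotone_apply_argmaxUpTo fun i => (s.1 * h i ω + s.2 * ζ i ω : ℝ))
    (ae_of_all _ fun ω => (hV ω).trans (iSup_mono fun n => EReal.coe_le_coe_iff.2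
      (le_apply_argmaxUpTo (fun i => (s.1 * h i ω + s.2 * ζ i ω : ℝ)) n)))
  refine key.trans (le_of_eq ?_)
  congr 1
  funext n
  rw [integral_add ((hh n).const_mul _) ((hζ n).const_mul _), integral_const_mul,
    integral_const_mul]

/-- Every value below the dual value of a fibre is exceeded by a normalized mixture of two members
of the countable family obtained by maximizing rational scores. -/
theorem exists_mixture_gt [IsProbabilityMeasure ν] {ζ h : ℕ → Ω → ℝ}
    (hζ : ∀ s n, Integrable (fun ω => ζ (bestIndex ζ h s n ω) ω) ν)
    (hh : ∀ s n, Integrable (fun ω => h (bestIndex ζ h s n ω) ω) ν)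
    (hnn : ∀ i ω, 0 ≤ ζ i ω)
    (hconj : ∀ (q : ℝ) ω,
      conj η φ (f ω - (q : EReal)) ≤ ⨆ i, ((h i ω - q * ζ i ω : ℝ) : EReal))
    (hlt : ∃ c < 1, ∀ ω, ∃ i, ζ i ω ≤ c) (hgt : ∃ c > 1, ∀ ω, ∃ i, c ≤ ζ i ω)
    {c : ℝ} (hc : (c : EReal) < fibreDual ν φ η f) {m J : (ℚ × ℚ) × ℕ → ℝ}
    (hm : ∀ a, m a = ∫ ω, ζ (bestIndex ζ h a.1 a.2 ω) ω ∂ν)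
    (hJ : ∀ a, J a = ∫ ω, h (bestIndex ζ h a.1 a.2 ω) ω ∂ν) :
    ∃ a b, m a ≤ 1 ∧ 1 < m b ∧
      c < (m b - 1) / (m b - m a) * J a + (1 - (m b - 1) / (m b - m a)) * J b := by
  have hconst : ∀ x : ℝ, expect ν (fun _ => (x : EReal)) = x := fun x => by
    rw [expect_coe (integrable_const x)]
    simp
  refine exists_chord_gt ?_ ?_ fun μ => ?_
  · obtain ⟨x, hx, hx'⟩ := hlt
    have key := expect_le_iSup_bestIndex (ν := ν) (V := fun _ => ((-x : ℝ) : EReal)) (0, -1)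
      (hζ _) (hh _) fun ω => by
        obtain ⟨i, hi⟩ := hx' ω
        exact le_iSup_of_le i (EReal.coe_le_coe_iff.2 (by push_cast; linarith))
    rw [hconst] at key
    obtain ⟨n, hn⟩ := lt_iSup_iff.1
      (lt_of_lt_of_le (EReal.coe_lt_coe_iff.2 (by linarith : (-1 : ℝ) < -x)) key)
    refine ⟨((0, -1), n), ?_⟩
    rw [hm]
    rw [EReal.coe_lt_coe_iff] at hn
    push_cast at hn
    linarith
  · obtain ⟨x, hx, hx'⟩ := hgt
    have key := expect_le_iSup_bestIndex (ν := ν) (V := fun _ => ((x : ℝ) : EReal)) (0, 1)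
      (hζ _) (hh _) fun ω => by
        obtain ⟨i, hi⟩ := hx' ω
        exact le_iSup_of_le i (EReal.coe_le_coe_iff.2 (by push_cast; linarith))
    rw [hconst] at key
    obtain ⟨n, hn⟩ := lt_iSup_iff.1
      (lt_of_lt_of_le (EReal.coe_lt_coe_iff.2 hx) key)
    refine ⟨((0, 1), n), ?_⟩
    rw [hm]
    rw [EReal.coe_lt_coe_iff] at hn
    push_cast at hn
    linarith
  · obtain ⟨c', hcc', hc'⟩ := EReal.lt_iff_exists_real_btwn.1 hc
    rw [EReal.coe_lt_coe_iff] at hcc'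
    -- A rational slope slightly larger than `μ` serves for `μ`, since the masses are nonnegative.
    obtain ⟨q, hμq, hq⟩ := exists_rat_btwn (by linarith : μ < μ + (c' - c))
    have h1 : (c' : EReal) < (q : ℝ) + expect ν fun ω => conj η φ (f ω - ((q : ℝ) : EReal)) :=
      lt_of_lt_of_le hc' (iInf_le (fun μ : ℝ =>
        ((μ : EReal) + expect ν fun ω => conj η φ (f ω - (μ : EReal)))) (q : ℝ))
    have key := expect_le_iSup_bestIndex (ν := ν)
      (V := fun ω => conj η φ (f ω - ((q : ℝ) : EReal))) (1, -q) (hζ _) (hh _) fun ω => by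
        refine (hconj q ω).trans (iSup_mono fun i => EReal.coe_le_coe_iff.2 ?_)
        push_cast
        linarith
    have h2 : ((c' - q : ℝ) : EReal) < expect ν fun ω => conj η φ (f ω - ((q : ℝ) : EReal)) := by
      rw [EReal.coe_sub]
      exact EReal.sub_lt_of_lt_add' h1
    obtain ⟨n, hn⟩ := lt_iSup_iff.1 (lt_of_lt_of_le h2 key)
    rw [EReal.coe_lt_coe_iff] at hn
    refine ⟨((1, -q), n), ?_⟩
    rw [hm, hJ]
    have hnn' : 0 ≤ ∫ ω, ζ (bestIndex ζ h (1, -q) n ω) ω ∂ν := integral_nonneg fun ω => hnn _ ω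
    push_cast at hn
    nlinarith

end Fibre


/-! ### Densities with a fixed first marginal -/

section Gain

variable {X : Type*} [MeasurableSpace X] {F : X → EReal} {φ : ℝ → ℝ≥0∞} {η : ℝ} {γ : Measure X}

/-- The nonnegative part `F⁺ ζ` of the primal integrand. -/
noncomputable def gainPos (F : X → EReal) (ζ : X → ℝ) (x : X) : ℝ≥0∞ :=
  (F x).toENNReal * ENNReal.ofReal (ζ x)

/-- The nonpositive part `F⁻ ζ + η φ(ζ)` of the primal integrand, with the sign reversed. -/
noncomputable def gainNeg (F : X → EReal) (φ : ℝ → ℝ≥0∞) (η : ℝ) (ζ : X → ℝ) (x : X) : ℝ≥0∞ :=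
  (-F x).toENNReal * ENNReal.ofReal (ζ x) + ENNReal.ofReal η * φ (ζ x)

theorem measurable_gainPos (hF : Measurable F) {ζ : X → ℝ} (hζ : Measurable ζ) :
    Measurable (gainPos F ζ) :=
  (measurable_ereal_toENNReal.comp hF).mul hζ.ennreal_ofReal

theorem measurable_gainNeg (hφ : IsDivergenceFunction φ) (hF : Measurable F) {ζ : X → ℝ}
    (hζ : Measurable ζ) : Measurable (gainNeg F φ η ζ) :=
  ((measurable_ereal_toENNReal.comp hF.neg).mul hζ.ennreal_ofReal).add
    ((hφ.lowerSemicontinuous.measurable.comp hζ).const_mul _)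

theorem lintegral_gainNeg (hF : Measurable F) (hφ : IsDivergenceFunction φ) {ζ : X → ℝ}
    (hζ : Measurable ζ) :
    ∫⁻ x, gainNeg F φ η ζ x ∂γ = ∫⁻ x, (-F x).toENNReal * ENNReal.ofReal (ζ x) ∂γ +
      ENNReal.ofReal η * ∫⁻ x, φ (ζ x) ∂γ := by
  unfold gainNeg
  rw [lintegral_add_left (f := fun x => (-F x).toENNReal * ENNReal.ofReal (ζ x))
    ((measurable_ereal_toENNReal.comp hF.neg).mul hζ.ennreal_ofReal),
    lintegral_const_mul (f := fun x => φ (ζ x)) _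
      (hφ.lowerSemicontinuous.measurable.comp hζ)]

theorem Admissible.integral_gain_le (hφ : IsDivergenceFunction φ) (hF : Measurable F)
    (hbot : ∀ x, F x ≠ ⊥) (hη : 0 < η) {ζ h : X → ℝ} (H : Admissible F φ η γ ζ h) :
    ((∫ x, h x ∂γ : ℝ) : EReal) ≤
      ((∫⁻ x, gainPos F ζ x ∂γ : ℝ≥0∞) : EReal) -
        ((∫⁻ x, gainNeg F φ η ζ x ∂γ : ℝ≥0∞) : EReal) := by
  have hfin : ∫⁻ x, gainNeg F φ η ζ x ∂γ ≠ ⊤ := by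
    rw [lintegral_gainNeg hF hφ H.measurable]
    exact ENNReal.add_ne_top.2 ⟨H.lintegral_neg.ne,
      ENNReal.mul_ne_top ENNReal.ofReal_ne_top H.lintegral_div.ne⟩
  rw [← expect_coe H.integrable_gain, ← expect_coe_sub_coe
    (measurable_gainPos hF H.measurable).aemeasurable
    (measurable_gainNeg hφ hF H.measurable).aemeasurable (Or.inr hfin)]
  refine expect_mono_ae (ae_of_all _ fun x => ?_)
  obtain ⟨r, hr, hh⟩ := H.gain_le x
  have e := coe_sub_coe_eq_gain (φ := φ) hη (hbot x) (H.nonneg x) 0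
  simp only [neg_zero, ENNReal.ofReal_zero, zero_mul, add_zero, EReal.coe_zero, sub_zero] at e
  unfold gainPos gainNeg
  rw [e, coe_mul_coe_of_ne_top (H.ne_top x)]
  refine (EReal.coe_le_coe_iff.2 hh).trans ?_
  rw [EReal.coe_sub, EReal.coe_mul]
  exact EReal.sub_le_sub
    (mul_le_mul_of_nonneg_right hr (EReal.coe_nonneg.2 (H.nonneg x))) le_rfl

end Gain

theorem coe_add_sub_eq (A B : ℝ≥0∞) (μ : ℝ) :
    (μ : EReal) + (((A + ENNReal.ofReal (-μ) : ℝ≥0∞) : EReal) -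
      ((B + ENNReal.ofReal μ : ℝ≥0∞) : EReal)) = (A : EReal) - (B : EReal) := by
  have hμ := max_zero_sub_eq_self μ
  by_cases hB : B = ⊤
  · rw [hB, top_add, EReal.coe_ennreal_top, sub_eq_add_neg, sub_eq_add_neg, EReal.neg_top,
      EReal.add_bot, EReal.add_bot, EReal.add_bot]
  · rw [EReal.coe_ennreal_add, EReal.coe_ennreal_add, EReal.coe_ennreal_ofReal,
      EReal.coe_ennreal_ofReal, ← EReal.coe_ennreal_toReal hB, ← EReal.coe_add]
    by_cases hA : A = ⊤
    · rw [hA, EReal.coe_ennreal_top, EReal.top_add_coe, EReal.top_sub_coe, EReal.top_sub_coe,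
        EReal.coe_add_top]
    · rw [← EReal.coe_ennreal_toReal hA, ← EReal.coe_add, ← EReal.coe_sub, ← EReal.coe_add,
        ← EReal.coe_sub]
      congr 1
      linarith

/-- For a probability density `t` the multiplier `μ` of the normalization drops out. -/
theorem add_expect_gain {Ω : Type*} [MeasurableSpace Ω] {ν : Measure Ω} {φ : ℝ → ℝ≥0∞} {η : ℝ}
    {f : Ω → EReal} (hφ : IsDivergenceFunction φ) (hη : 0 < η) (hf : Measurable f)
    (hbot : ∀ ω, f ω ≠ ⊥) {t : Ω → ℝ} (ht : Measurable t) (ht0 : ∀ᵐ ω ∂ν, 0 ≤ t ω)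
    (ht1 : ∫⁻ ω, ENNReal.ofReal (t ω) ∂ν = 1)
    (hfin : ∫⁻ ω, gainPos f t ω ∂ν ≠ ⊤ ∨ ∫⁻ ω, gainNeg f φ η t ω ∂ν ≠ ⊤) (μ : ℝ) :
    (μ : EReal) + expect ν (fun ω => (f ω - (μ : EReal)) * (t ω : EReal) -
      (η : EReal) * ((φ (t ω) : ℝ≥0∞) : EReal)) =
      ((∫⁻ ω, gainPos f t ω ∂ν : ℝ≥0∞) : EReal) -
        ((∫⁻ ω, gainNeg f φ η t ω ∂ν : ℝ≥0∞) : EReal) := by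
  have hconst : ∀ c : ℝ, ∫⁻ ω, ENNReal.ofReal c * ENNReal.ofReal (t ω) ∂ν = ENNReal.ofReal c :=
    fun c => by rw [lintegral_const_mul _ ht.ennreal_ofReal, ht1, mul_one]
  have hP := measurable_gainPos hf ht
  have hM := measurable_gainNeg (η := η) hφ hf ht
  have hP' : ∫⁻ ω, (gainPos f t ω + ENNReal.ofReal (-μ) * ENNReal.ofReal (t ω)) ∂ν =
      ∫⁻ ω, gainPos f t ω ∂ν + ENNReal.ofReal (-μ) := by
    rw [lintegral_add_left hP, hconst]
  have hM' : ∫⁻ ω, (gainNeg f φ η t ω + ENNReal.ofReal μ * ENNReal.ofReal (t ω)) ∂ν =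
      ∫⁻ ω, gainNeg f φ η t ω ∂ν + ENNReal.ofReal μ := by
    rw [lintegral_add_left hM, hconst]
  have e : expect ν (fun ω => (f ω - (μ : EReal)) * (t ω : EReal) -
      (η : EReal) * ((φ (t ω) : ℝ≥0∞) : EReal)) =
      expect ν fun ω => ((gainPos f t ω + ENNReal.ofReal (-μ) * ENNReal.ofReal (t ω) : ℝ≥0∞) :
        EReal) - ((gainNeg f φ η t ω + ENNReal.ofReal μ * ENNReal.ofReal (t ω) : ℝ≥0∞) : EReal) :=
    expect_congr_ae (ht0.mono fun ω h => (coe_sub_coe_eq_gain hη (hbot ω) h μ).symm)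
  rw [e, expect_coe_sub_coe
    (a := fun ω => gainPos f t ω + ENNReal.ofReal (-μ) * ENNReal.ofReal (t ω))
    (b := fun ω => gainNeg f φ η t ω + ENNReal.ofReal μ * ENNReal.ofReal (t ω)) (hP.add (ht.ennreal_ofReal.const_mul _)).aemeasurable
    (hM.add (ht.ennreal_ofReal.const_mul _)).aemeasurable, hP', hM', coe_add_sub_eq]
  rw [hP', hM']
  exact hfin.imp (fun h => ENNReal.add_ne_top.2 ⟨h, ENNReal.ofReal_ne_top⟩)
    fun h => ENNReal.add_ne_top.2 ⟨h, ENNReal.ofReal_ne_top⟩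

section Kernel

variable {Z Ω : Type*} [MeasurableSpace Z] [MeasurableSpace Ω] {P : Measure Z} [SFinite P]
  {ν : Kernel Z Ω} [IsSFiniteKernel ν] {φ : ℝ → ℝ≥0∞} {η : ℝ} {f : Ω → EReal}

theorem expect_lintegral_sub_lintegral {a b : Z × Ω → ℝ≥0∞} (ha : Measurable a)
    (hb : Measurable b) (hab : ∫⁻ p, a p ∂(P ⊗ₘ ν) ≠ ⊤ ∨ ∫⁻ p, b p ∂(P ⊗ₘ ν) ≠ ⊤) :
    expect P (fun z => ((∫⁻ ω, a (z, ω) ∂ν z : ℝ≥0∞) : EReal) -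
      ((∫⁻ ω, b (z, ω) ∂ν z : ℝ≥0∞) : EReal)) =
      ((∫⁻ p, a p ∂(P ⊗ₘ ν) : ℝ≥0∞) : EReal) - ((∫⁻ p, b p ∂(P ⊗ₘ ν) : ℝ≥0∞) : EReal) := by
  rw [Measure.lintegral_compProd ha, Measure.lintegral_compProd hb] at *
  exact expect_coe_sub_coe ha.lintegral_kernel_prod_right'.aemeasurable
    hb.lintegral_kernel_prod_right'.aemeasurable hab

theorem ae_lintegral_ne_top_or {a b : Z × Ω → ℝ≥0∞} (ha : Measurable a)
    (hb : Measurable b) (hab : ∫⁻ p, a p ∂(P ⊗ₘ ν) ≠ ⊤ ∨ ∫⁻ p, b p ∂(P ⊗ₘ ν) ≠ ⊤) :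
    ∀ᵐ z ∂P, ∫⁻ ω, a (z, ω) ∂ν z ≠ ⊤ ∨ ∫⁻ ω, b (z, ω) ∂ν z ≠ ⊤ := by
  rw [Measure.lintegral_compProd ha, Measure.lintegral_compProd hb] at hab
  rcases hab with h | h
  · filter_upwards [ae_lt_top ha.lintegral_kernel_prod_right' h] with z hz using Or.inl hz.ne
  · filter_upwards [ae_lt_top hb.lintegral_kernel_prod_right' h] with z hz using Or.inr hz.ne

/-- Weak duality: on each fibre the gain of a normalized density is at most `μ` plus the expectation
of the conjugate. -/
theorem lintegral_gain_le_expect_fibreDual (hφ : IsDivergenceFunction φ) (hη : 0 < η)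
    (hf : Measurable f) (hbot : ∀ ω, f ω ≠ ⊥) {ζ : Z × Ω → ℝ} (hζ : Measurable ζ)
    (hζ0 : ∀ᵐ z ∂P, ∀ᵐ ω ∂ν z, 0 ≤ ζ (z, ω))
    (hζ1 : ∀ᵐ z ∂P, ∫⁻ ω, ENNReal.ofReal (ζ (z, ω)) ∂ν z = 1)
    (hfin : ∫⁻ p, gainPos (fun p : Z × Ω => f p.2) ζ p ∂(P ⊗ₘ ν) ≠ ⊤ ∨
      ∫⁻ p, gainNeg (fun p : Z × Ω => f p.2) φ η ζ p ∂(P ⊗ₘ ν) ≠ ⊤) :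
    ((∫⁻ p, gainPos (fun p : Z × Ω => f p.2) ζ p ∂(P ⊗ₘ ν) : ℝ≥0∞) : EReal) -
      ((∫⁻ p, gainNeg (fun p : Z × Ω => f p.2) φ η ζ p ∂(P ⊗ₘ ν) : ℝ≥0∞) : EReal) ≤
      expect P fun z => fibreDual (ν z) φ η f := by
  have hF : Measurable fun p : Z × Ω => f p.2 := hf.comp measurable_snd
  rw [← expect_lintegral_sub_lintegral (measurable_gainPos hF hζ)
    (measurable_gainNeg hφ hF hζ) hfin]
  refine expect_mono_ae ?_
  filter_upwards [hζ0, hζ1, ae_lintegral_ne_top_or (measurable_gainPos hF hζ)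
    (measurable_gainNeg hφ hF hζ) hfin] with z h0 h1 hz
  refine le_iInf fun μ => ?_
  refine (add_expect_gain hφ hη hf hbot (t := fun ω => ζ (z, ω))
    (hζ.comp measurable_prodMk_left) h0 h1 hz μ).ge.trans ?_
  gcongr
  exact expect_mono_ae (ae_of_all _ fun ω => le_conj _ _)

/-- A density made of subgradients of the conjugate closes the duality gap. -/
theorem expect_fibreDual_le_lintegral_gain (hφ : IsDivergenceFunction φ) (hη : 0 < η)
    (hf : Measurable f) (hbot : ∀ ω, f ω ≠ ⊥) {ζ : Z × Ω → ℝ} (hζ : Measurable ζ)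
    (hζ0 : ∀ᵐ z ∂P, ∀ᵐ ω ∂ν z, 0 ≤ ζ (z, ω))
    (hζ1 : ∀ᵐ z ∂P, ∫⁻ ω, ENNReal.ofReal (ζ (z, ω)) ∂ν z = 1) {μ : Z → ℝ}
    (hsub : ∀ᵐ z ∂P, ∀ᵐ ω ∂ν z, IsConjSubgradient η φ (f ω - (μ z : EReal)) (ζ (z, ω)))
    (hfin : ∫⁻ p, gainPos (fun p : Z × Ω => f p.2) ζ p ∂(P ⊗ₘ ν) ≠ ⊤ ∨
      ∫⁻ p, gainNeg (fun p : Z × Ω => f p.2) φ η ζ p ∂(P ⊗ₘ ν) ≠ ⊤) :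
    expect P (fun z => fibreDual (ν z) φ η f) ≤
      ((∫⁻ p, gainPos (fun p : Z × Ω => f p.2) ζ p ∂(P ⊗ₘ ν) : ℝ≥0∞) : EReal) -
      ((∫⁻ p, gainNeg (fun p : Z × Ω => f p.2) φ η ζ p ∂(P ⊗ₘ ν) : ℝ≥0∞) : EReal) := by
  have hF : Measurable fun p : Z × Ω => f p.2 := hf.comp measurable_snd
  rw [← expect_lintegral_sub_lintegral (measurable_gainPos hF hζ)
    (measurable_gainNeg hφ hF hζ) hfin]
  refine expect_mono_ae ?_
  filter_upwards [hζ0, hζ1, hsub, ae_lintegral_ne_top_or (measurable_gainPos hF hζ)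
    (measurable_gainNeg hφ hF hζ) hfin] with z h0 h1 hs hz
  refine (iInf_le _ (μ z)).trans (le_trans ?_ (add_expect_gain hφ hη hf hbot
    (t := fun ω => ζ (z, ω)) (hζ.comp measurable_prodMk_left) h0 h1 hz (μ z)).le)
  gcongr
  exact expect_mono_ae (hs.mono fun ω h => h.conj_le hφ hη)

end Kernel

/-! ### Strong duality -/

section Strong

variable {Z Ω : Type*} [MeasurableSpace Z] [MeasurableSpace Ω] {P : Measure Z} [SFinite P]
  {ν : Kernel Z Ω} [IsSFiniteKernel ν] {φ : ℝ → ℝ≥0∞} {η : ℝ} {f : Ω → EReal}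

theorem integrable_integral_of_compProd {u : Z × Ω → ℝ} (hu : Measurable u)
    (hui : Integrable u (P ⊗ₘ ν)) : Integrable (fun z => ∫ ω, u (z, ω) ∂ν z) P :=
  (((Measure.integrable_compProd_iff hui.aestronglyMeasurable).1 hui).2).mono'
    hu.stronglyMeasurable.integral_kernel_prod_right'.aestronglyMeasurable
    (ae_of_all _ fun _ => norm_integral_le_integral_norm _)

theorem ae_integrable_of_compProd {u : Z × Ω → ℝ} (hui : Integrable u (P ⊗ₘ ν)) :
    ∀ᵐ z ∂P, Integrable (fun ω => u (z, ω)) (ν z) :=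
  ((Measure.integrable_compProd_iff hui.aestronglyMeasurable).1 hui).1

/-- Countably many normalized admissible densities that reach the dual value on almost every fibre
reach the dual value globally: among finitely many of them the best one on each fibre is again
admissible, and the best gains increase to their supremum. -/
theorem expect_fibreDual_le_of_family (hφ : IsDivergenceFunction φ) (hf : Measurable f)
    {ι : Type*} [Countable ι] [Nonempty ι] {ζ h : ι → Z × Ω → ℝ}
    (H : ∀ i, Admissible (fun p : Z × Ω => f p.2) φ η (P ⊗ₘ ν) (ζ i) (h i))
    (H1 : ∀ i, ∀ᵐ z ∂P, ∫ ω, ζ i (z, ω) ∂ν z = 1)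
    (hV : ∀ᵐ z ∂P, fibreDual (ν z) φ η f ≤ ⨆ i, ((∫ ω, h i (z, ω) ∂ν z : ℝ) : EReal))
    {B : EReal}
    (hB : ∀ ζ h : Z × Ω → ℝ, Admissible (fun p : Z × Ω => f p.2) φ η (P ⊗ₘ ν) ζ h →
      (∀ᵐ z ∂P, ∫ ω, ζ (z, ω) ∂ν z = 1) → ((∫ p, h p ∂(P ⊗ₘ ν) : ℝ) : EReal) ≤ B) :
    expect P (fun z => fibreDual (ν z) φ η f) ≤ B := by
  obtain ⟨e, he⟩ := exists_surjective_nat ι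
  have hF : Measurable fun p : Z × Ω => f p.2 := hf.comp measurable_snd
  set s : ℕ → Z → ℝ := fun n z => ∫ ω, h (e n) (z, ω) ∂ν z with hs
  have hsm : ∀ n, Measurable (s n) := fun n =>
    ((H (e n)).measurable_gain.stronglyMeasurable.integral_kernel_prod_right').measurable
  let k : ℕ → Z → ℕ := fun n z => argmaxUpTo (fun i => s i z) n
  have hk : ∀ n, Measurable (k n) := fun n => measurable_argmaxUpTo hsm n
  have hadm : ∀ n, Admissible (fun p : Z × Ω => f p.2) φ η (P ⊗ₘ ν)
      (fun p => ζ (e (k n p.1)) p) (fun p => h (e (k n p.1)) p) := fun n =>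
    Admissible.select (ζ := fun i => ζ (e i)) (h := fun i => h (e i)) hφ hF (fun i => H (e i))
      ((hk n).comp measurable_fst) (n := n) fun p => argmaxUpTo_le _ _
  have hnorm : ∀ n, ∀ᵐ z ∂P, ∫ ω, ζ (e (k n z)) (z, ω) ∂ν z = 1 := fun n => by
    filter_upwards [ae_all_iff.2 fun i => H1 (e i)] with z hz using hz _
  refine (expect_le_iSup_integral (g := fun n z => s (k n z) z) (fun n => ?_)
    (ae_of_all _ fun z => monotone_apply_argmaxUpTo fun i => s i z) ?_).trans
    (iSup_le fun n => ?_)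
  · exact integrable_integral_of_compProd (hadm n).measurable_gain (hadm n).integrable_gain
  · filter_upwards [hV] with z hz
    refine hz.trans (iSup_le fun i => ?_)
    obtain ⟨n, rfl⟩ := he i
    exact le_iSup_of_le n (EReal.coe_le_coe_iff.2 (le_apply_argmaxUpTo (fun i => s i z) n))
  · refine le_trans (le_of_eq ?_) (hB _ _ (hadm n) (hnorm n))
    rw [Measure.integral_compProd (hadm n).integrable_gain]

end Strong


section Strong

variable {Z Ω : Type*} [MeasurableSpace Z] [MeasurableSpace Ω] {P : Measure Z} [IsFiniteMeasure P]
  {ν : Kernel Z Ω} [IsFiniteKernel ν] {φ : ℝ → ℝ≥0∞} {η : ℝ} {f : Ω → EReal}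

/-- The case in which `φ` is finite on both sides of `1`, so that the constraint `E[ζ] = 1` has
interior points. -/
theorem expect_fibreDual_le_of_interior (hν : ∀ᵐ z ∂P, IsProbabilityMeasure (ν z))
    (hφ : IsDivergenceFunction φ) (hη : 0 < η) (hf : Measurable f) (hbot : ∀ ω, f ω ≠ ⊥)
    (hlt : ∃ t, t < 1 ∧ φ t ≠ ⊤) (hgt : ∃ t, 1 < t ∧ φ t ≠ ⊤) {ζ₀ h₀ : Z × Ω → ℝ}
    (H₀ : Admissible (fun p : Z × Ω => f p.2) φ η (P ⊗ₘ ν) ζ₀ h₀)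
    (H₀1 : ∀ᵐ z ∂P, ∫ ω, ζ₀ (z, ω) ∂ν z = 1) {B : EReal}
    (hB : ∀ ζ h : Z × Ω → ℝ, Admissible (fun p : Z × Ω => f p.2) φ η (P ⊗ₘ ν) ζ h →
      (∀ᵐ z ∂P, ∫ ω, ζ (z, ω) ∂ν z = 1) → ((∫ p, h p ∂(P ⊗ₘ ν) : ℝ) : EReal) ≤ B) :
    expect P (fun z => fibreDual (ν z) φ η f) ≤ B := by
  set F : Z × Ω → EReal := fun p => f p.2 with hFdef
  have hF : Measurable F := hf.comp measurable_snd
  obtain ⟨d, hd, hdense⟩ := hφ.exists_dense_seq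
  let e : ℕ ≃ ℕ × ℕ × ℕ := (Denumerable.eqv (ℕ × ℕ × ℕ)).symm
  set ζ : ℕ → Z × Ω → ℝ := fun i => overwrite F (d (e i).1) (e i).2.1 ζ₀ with hζ
  set h : ℕ → Z × Ω → ℝ := fun i =>
    overwriteGain F φ η (d (e i).1) (e i).2.1 (e i).2.2 h₀ with hh
  have H : ∀ i, Admissible F φ η (P ⊗ₘ ν) (ζ i) (h i) := fun i => H₀.overwrite hφ hF (hd _) _ _
  let I := (ℚ × ℚ) × ℕ
  set ζb : I → Z × Ω → ℝ := fun a p => ζ (bestIndex ζ h a.1 a.2 p) p with hζb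
  set hb : I → Z × Ω → ℝ := fun a p => h (bestIndex ζ h a.1 a.2 p) p with hhb
  have Hb : ∀ a, Admissible F φ η (P ⊗ₘ ν) (ζb a) (hb a) := fun a =>
    Admissible.select hφ hF H (measurable_argmaxUpTo (fun i =>
      ((H i).measurable_gain.const_mul _).add ((H i).measurable.const_mul _)) a.2)
      fun p => argmaxUpTo_le _ _
  set m : I → Z → ℝ := fun a z => ∫ ω, ζb a (z, ω) ∂ν z with hm
  set J : I → Z → ℝ := fun a z => ∫ ω, hb a (z, ω) ∂ν z with hJ
  have hmm : ∀ a, Measurable (m a) := fun a =>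
    ((Hb a).measurable.stronglyMeasurable.integral_kernel_prod_right').measurable
  let good : I × I → Set Z := fun c => {z | m c.1 z ≤ 1 ∧ 1 < m c.2 z}
  have hgood : ∀ c, MeasurableSet (good c) := fun c =>
    (measurableSet_le (hmm c.1) measurable_const).inter (measurableSet_lt measurable_const (hmm c.2))
  -- The mixture of `c.1` and `c.2` with mass `1`, on the fibres on which there is one.
  let w : I × I → Z → ℝ := fun c =>
    (good c).indicator fun z => (m c.2 z - 1) / (m c.2 z - m c.1 z)
  have hw : ∀ c, Measurable (w c) := fun c =>
    (((hmm c.2).sub_const 1).div ((hmm c.2).sub (hmm c.1))).indicator (hgood c)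
  have hw01 : ∀ c z, 0 ≤ w c z ∧ w c z ≤ 1 := fun c z => by
    by_cases hz : z ∈ good c
    · simp only [w, Set.indicator_of_mem hz]
      have h1 : m c.1 z ≤ 1 := hz.1
      have h2 : 1 < m c.2 z := hz.2
      exact ⟨div_nonneg (by linarith) (by linarith), (div_le_one (by linarith)).2 (by linarith)⟩
    · simp only [w, Set.indicator_of_notMem hz]
      exact ⟨le_rfl, zero_le_one⟩
  let v : I × I → Z → ℝ := fun c => (good c).indicator 1
  have hv : ∀ c, Measurable (v c) := fun c => measurable_one.indicator (hgood c)
  have hv01 : ∀ c z, 0 ≤ v c z ∧ v c z ≤ 1 := fun c z => by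
    by_cases hz : z ∈ good c
    · simp [v, Set.indicator_of_mem hz]
    · simp [v, Set.indicator_of_notMem hz]
  have Hmix := fun c : I × I => ((Hb c.1).mix hφ hF hη (Hb c.2) ((hw c).comp measurable_fst)
    (fun p => (hw01 c p.1).1) (fun p => (hw01 c p.1).2)).mix hφ hF hη H₀
      ((hv c).comp measurable_fst) (fun p => (hv01 c p.1).1) (fun p => (hv01 c p.1).2)
  have hint : ∀ᵐ z ∂P, ∀ a, Integrable (fun ω => ζb a (z, ω)) (ν z) ∧
      Integrable (fun ω => hb a (z, ω)) (ν z) :=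
    ae_all_iff.2 fun a => (ae_integrable_of_compProd (Hb a).integrable).and
      (ae_integrable_of_compProd (Hb a).integrable_gain)
  have hlin : ∀ (z : Z) (x : ℝ) (u u' : Ω → ℝ), Integrable u (ν z) → Integrable u' (ν z) →
      ∫ ω, (x * u ω + (1 - x) * u' ω) ∂ν z = x * ∫ ω, u ω ∂ν z + (1 - x) * ∫ ω, u' ω ∂ν z :=
    fun z x u u' hu hu' => by
      rw [integral_add (hu.const_mul _) (hu'.const_mul _), integral_const_mul, integral_const_mul]
  refine expect_fibreDual_le_of_family hφ hf Hmix (fun c => ?_) ?_ hB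
  · filter_upwards [hint, H₀1, ae_integrable_of_compProd H₀.integrable] with z hz h1 h0
    by_cases hzc : z ∈ good c
    · have h1 : m c.1 z ≤ 1 := hzc.1
      have h2 : 1 < m c.2 z := hzc.2
      simp only [Function.comp_apply, v, w, Set.indicator_of_mem hzc, Pi.one_apply, one_mul,
        sub_self, zero_mul, add_zero]
      rw [hlin z _ _ _ (hz c.1).1 (hz c.2).1]
      change (m c.2 z - 1) / (m c.2 z - m c.1 z) * m c.1 z +
        (1 - (m c.2 z - 1) / (m c.2 z - m c.1 z)) * m c.2 z = 1
      have : m c.2 z - m c.1 z ≠ 0 := by linarith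
      field_simp
      ring
    · simp only [Function.comp_apply, v, Set.indicator_of_notMem hzc, zero_mul, zero_add,
        sub_zero, one_mul]
      exact h1
  · filter_upwards [hint, hν] with z hz hprob
    refine EReal.ge_of_forall_gt_iff_ge.1 fun c hc => ?_
    have hdom : ∀ {p : ℝ → Prop} (t : ℝ), φ t ≠ ⊤ → (∃ ε > 0, ∀ x, |x - t| < ε → p x) →
        ∃ i, p (d i) := fun {p} t ht ⟨ε, hε, hp⟩ => by
      obtain ⟨i, hi, -⟩ := hdense t ht ε hε
      exact ⟨i, hp _ hi⟩
    have hon : ∀ (i : ℕ) (ω : Ω), ∃ j, ζ j (z, ω) = d i := fun i ω => by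
      obtain ⟨n, hn⟩ : ∃ n : ℕ, ((-(n : ℝ) : ℝ) : EReal) ≤ f ω := by
        induction hfω : f ω with
        | bot => exact absurd hfω (hbot ω)
        | top => exact ⟨0, le_top⟩
        | coe r =>
          obtain ⟨n, hn⟩ := exists_nat_ge (-r)
          exact ⟨n, EReal.coe_le_coe_iff.2 (by linarith)⟩
      refine ⟨e.symm (i, n, 0), ?_⟩
      simp only [hζ, Equiv.apply_symm_apply]
      exact if_pos hn
    obtain ⟨a, b, ha, hab, hcab⟩ := exists_mixture_gt (ν := ν z) (φ := φ) (η := η) (f := f)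
      (ζ := fun i ω => ζ i (z, ω)) (h := fun i ω => h i (z, ω))
      (fun s n => (hz (s, n)).1) (fun s n => (hz (s, n)).2) (fun i ω => (H i).nonneg _)
      (fun q ω => by
        refine (conj_sub_le_iSup_overwrite hφ hη hdense ζ₀ h₀ q (F := F) (x := (z, ω))
          (hbot ω)).trans (le_of_eq ?_)
        exact (e.iSup_comp (g := fun k : ℕ × ℕ × ℕ =>
          ((overwriteGain F φ η (d k.1) k.2.1 k.2.2 h₀ (z, ω) -
            q * overwrite F (d k.1) k.2.1 ζ₀ (z, ω) : ℝ) : EReal))).symm)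
      (by
        obtain ⟨t, ht, ht'⟩ := hlt
        obtain ⟨i, hi⟩ := hdom (p := fun x => x < 1) t ht' ⟨1 - t, by linarith, fun x hx => by
          linarith [(abs_lt.1 hx).2]⟩
        exact ⟨d i, hi, fun ω => (hon i ω).imp fun j hj => hj.le⟩)
      (by
        obtain ⟨t, ht, ht'⟩ := hgt
        obtain ⟨i, hi⟩ := hdom (p := fun x => 1 < x) t ht' ⟨t - 1, by linarith, fun x hx => by
          linarith [(abs_lt.1 hx).1]⟩
        exact ⟨d i, hi, fun ω => (hon i ω).imp fun j hj => hj.ge⟩)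
      hc (m := fun a => m a z) (J := fun a => J a z) (fun a => rfl) (fun a => rfl)
    have hzc : z ∈ good (a, b) := ⟨ha, hab⟩
    refine le_iSup_of_le (a, b) (EReal.coe_le_coe_iff.2 (hcab.le.trans (le_of_eq ?_)))
    simp only [Function.comp_apply, v, w, Set.indicator_of_mem hzc, Pi.one_apply, one_mul,
      sub_self, zero_mul, add_zero]
    rw [hlin z _ _ _ (hz a).2 (hz b).2]

theorem integrable_toReal_min {X : Type*} [MeasurableSpace X] {γ : Measure X} [IsFiniteMeasure γ]
    {F : X → EReal} (hF : Measurable F) (hneg : ∫⁻ x, (-F x).toENNReal ∂γ ≠ ⊤) (N : ℕ) :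
    Integrable (fun x => (min (F x) ((N : ℝ) : EReal)).toReal) γ := by
  have hFm : Measurable fun x => (-F x).toENNReal := measurable_ereal_toENNReal.comp hF.neg
  refine Integrable.mono' ((integrable_const (N : ℝ)).add
    (integrable_toReal_of_lintegral_ne_top hFm.aemeasurable hneg))
    (hF.min measurable_const).ereal_toReal.aestronglyMeasurable ?_
  have hN : (0 : ℝ) ≤ N := Nat.cast_nonneg N
  filter_upwards [ae_lt_top hFm hneg] with x hx
  have h0 : 0 ≤ (-F x).toENNReal.toReal := ENNReal.toReal_nonneg
  simp only [Pi.add_apply, Real.norm_eq_abs]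
  induction hFx : F x with
  | bot => simp [hFx] at hx
  | top =>
    rw [min_eq_right le_top, EReal.toReal_coe, abs_of_nonneg hN]
    simp
  | coe r =>
    have e : min (r : EReal) ((N : ℝ) : EReal) = ((min r N : ℝ) : EReal) := by
      rcases le_total r N with h | h
      · rw [min_eq_left h, min_eq_left (EReal.coe_le_coe_iff.2 h)]
      · rw [min_eq_right h, min_eq_right (EReal.coe_le_coe_iff.2 h)]
    rw [e, EReal.toReal_coe, ← EReal.coe_neg, EReal.real_coe_toENNReal, ENNReal.toReal_ofReal',
      abs_le]
    constructor
    · rcases min_choice r N with h | h <;> rw [h] <;> linarith [le_max_left (-r) 0,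
        le_max_right (-r) 0]
    · linarith [min_le_right r N, le_max_right (-r) 0]

/-- If the domain of `φ` is bounded and lies on one side of `1`, then `(ηφ)^*(s)` exceeds `s` only
for `s` of one sign. -/
theorem conj_coe_le_of_one_sided (hη : 0 < η) {σ C : ℝ} (hσ : σ * σ = 1)
    (hdom : ∀ t, φ t ≠ ⊤ → 0 ≤ σ * (t - 1) ∧ σ * (t - 1) ≤ C) (r : ℝ) :
    conj η φ r ≤ ((r + C * max (σ * r) 0 : ℝ) : EReal) :=
  conj_coe_le hη fun t ht => by
    obtain ⟨h0, h1⟩ := hdom t ht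
    have hpos : 0 ≤ η * (φ t).toReal := mul_nonneg hη.le ENNReal.toReal_nonneg
    have h2 : (σ * r) * (σ * (t - 1)) ≤ max (σ * r) 0 * C :=
      mul_le_mul (le_max_left _ _) h1 h0 (le_max_right _ _)
    have h3 : (σ * r) * (σ * (t - 1)) = r * (t - 1) := by linear_combination r * (t - 1) * hσ
    linarith

/-- The dual value of a fibre is at most `E_ν[f]` if the domain of `φ` is bounded and on one side
of `1`: in the limit `μ → ±∞` the conjugate acts as the identity. -/
theorem fibreDual_le_expect {ν : Measure Ω} [IsProbabilityMeasure ν] (hη : 0 < η)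
    (hf : Measurable f) (hneg : ∫⁻ ω, (-f ω).toENNReal ∂ν ≠ ⊤) {σ C : ℝ}
    (hσ : σ * σ = 1) (hdom : ∀ t, φ t ≠ ⊤ → 0 ≤ σ * (t - 1) ∧ σ * (t - 1) ≤ C) :
    fibreDual ν φ η f ≤ expect ν f := by
  have hfm : Measurable fun x => (-f x).toENNReal := measurable_ereal_toENNReal.comp hf.neg
  have hfp : Measurable fun x => (f x).toENNReal := measurable_ereal_toENNReal.comp hf
  by_cases hpos : ∫⁻ ω, (f ω).toENNReal ∂ν = ⊤
  · refine le_top.trans (le_of_eq ?_)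
    unfold expect
    rw [hpos, ← EReal.coe_ennreal_toReal hneg, EReal.coe_ennreal_top, EReal.top_sub_coe]
  set g : Ω → ℝ := fun ω => (f ω).toReal with hg
  have hgf : ∀ᵐ ω ∂ν, f ω = (g ω : EReal) := by
    filter_upwards [ae_lt_top hfm hneg, ae_lt_top hfp hpos] with ω h1 h2
    refine (EReal.coe_toReal ?_ ?_).symm
    · intro h; simp [h] at h2
    · intro h; simp [h] at h1
  have hgi : Integrable g ν := by
    refine Integrable.mono' ((integrable_toReal_of_lintegral_ne_top hfp.aemeasurable hpos).add
      (integrable_toReal_of_lintegral_ne_top hfm.aemeasurable hneg))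
      hf.ereal_toReal.aestronglyMeasurable ?_
    filter_upwards [hgf] with ω hω
    simp only [Pi.add_apply, Real.norm_eq_abs]
    rw [hω, ← EReal.coe_neg, EReal.real_coe_toENNReal, EReal.real_coe_toENNReal,
      ENNReal.toReal_ofReal', ENNReal.toReal_ofReal', max_comm, max_comm (-g ω)]
    rw [abs_eq_max_neg]
    refine max_le ?_ ?_ <;>
    linarith [le_max_left 0 (g ω), le_max_right 0 (g ω), le_max_left 0 (-g ω),
      le_max_right 0 (-g ω)]
  rw [expect_congr_ae hgf, expect_coe hgi]
  have hexc : ∀ n : ℕ, Integrable (fun ω => max (σ * (g ω - σ * n)) 0) ν := fun n =>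
    ((hgi.sub (integrable_const (σ * n))).const_mul σ).pos_part
  have hlim : Filter.Tendsto (fun n : ℕ => ∫ ω, max (σ * (g ω - σ * n)) 0 ∂ν) Filter.atTop
      (nhds (∫ _, (0 : ℝ) ∂ν)) := by
    refine tendsto_integral_of_dominated_convergence (fun ω => |σ * g ω|)
      (fun n => (hexc n).aestronglyMeasurable) (hgi.const_mul σ).abs (fun n => ae_of_all _ fun ω => ?_)
      (ae_of_all _ fun ω => ?_)
    · have : (0 : ℝ) ≤ n := Nat.cast_nonneg n
      have e : σ * (g ω - σ * n) = σ * g ω - n := by linear_combination (-(n : ℝ)) * hσ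
      rw [Real.norm_of_nonneg (le_max_right _ _), e]
      exact max_le (by linarith [le_abs_self (σ * g ω)]) (abs_nonneg _)
    · obtain ⟨N, hN⟩ := exists_nat_ge (σ * g ω)
      refine tendsto_const_nhds.congr' ?_
      filter_upwards [Filter.eventually_ge_atTop N] with n hn
      have hn' : (N : ℝ) ≤ n := Nat.cast_le.2 hn
      have e : σ * (g ω - σ * n) = σ * g ω - n := by linear_combination (-(n : ℝ)) * hσ
      rw [e, max_eq_right (by linarith)]
  have hbound : ∀ n : ℕ, fibreDual ν φ η f ≤
      ((∫ ω, g ω ∂ν + C * ∫ ω, max (σ * (g ω - σ * n)) 0 ∂ν : ℝ) : EReal) := fun n => by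
    refine (iInf_le _ (σ * n)).trans ?_
    have h1 : expect ν (fun ω => conj η φ (f ω - ((σ * n : ℝ) : EReal))) ≤
        expect ν fun ω => ((g ω - σ * n + C * max (σ * (g ω - σ * n)) 0 : ℝ) : EReal) := by
      refine expect_mono_ae ?_
      filter_upwards [hgf] with ω hω
      rw [hω, ← EReal.coe_sub]
      exact conj_coe_le_of_one_sided hη hσ hdom _
    have hsub : Integrable (fun ω => g ω - σ * n) ν := hgi.sub (integrable_const _)
    rw [expect_coe (g := fun ω => g ω - σ * n + C * max (σ * (g ω - σ * n)) 0) (hsub.add ((hexc n).const_mul C)), integral_add hsub ((hexc n).const_mul C),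
      integral_sub hgi (integrable_const _)] at h1
    refine (add_le_add le_rfl h1).trans (le_of_eq ?_)
    rw [← EReal.coe_add, integral_const, probReal_univ, one_smul, integral_const_mul]
    congr 1
    ring
  have hlim' : Filter.Tendsto (fun n : ℕ => ((∫ ω, g ω ∂ν +
      C * ∫ ω, max (σ * (g ω - σ * n)) 0 ∂ν : ℝ) : EReal)) Filter.atTop
      (nhds ((∫ ω, g ω ∂ν : ℝ) : EReal)) := by
    refine (continuous_coe_real_ereal.tendsto _).comp ?_
    simpa using (hlim.const_mul C).const_add (∫ ω, g ω ∂ν)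
  exact ge_of_tendsto' hlim' hbound

/-- The case of a bounded domain on one side of `1`: the only normalized density is `1`. -/
theorem expect_fibreDual_le_of_one_sided (hν : ∀ᵐ z ∂P, IsProbabilityMeasure (ν z))
    (hφ : IsDivergenceFunction φ) (hη : 0 < η) (hf : Measurable f) (hbot : ∀ ω, f ω ≠ ⊥) {σ C : ℝ}
    (hσ : σ * σ = 1) (hdom : ∀ t, φ t ≠ ⊤ → 0 ≤ σ * (t - 1) ∧ σ * (t - 1) ≤ C)
    {ζ₀ h₀ : Z × Ω → ℝ} (H₀ : Admissible (fun p : Z × Ω => f p.2) φ η (P ⊗ₘ ν) ζ₀ h₀)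
    (H₀1 : ∀ᵐ z ∂P, ∫ ω, ζ₀ (z, ω) ∂ν z = 1) {B : EReal}
    (hB : ∀ ζ h : Z × Ω → ℝ, Admissible (fun p : Z × Ω => f p.2) φ η (P ⊗ₘ ν) ζ h →
      (∀ᵐ z ∂P, ∫ ω, ζ (z, ω) ∂ν z = 1) → ((∫ p, h p ∂(P ⊗ₘ ν) : ℝ) : EReal) ≤ B) :
    expect P (fun z => fibreDual (ν z) φ η f) ≤ B := by
  set F : Z × Ω → EReal := fun p => f p.2 with hFdef
  have hF : Measurable F := hf.comp measurable_snd
  have hone : ∀ᵐ p ∂(P ⊗ₘ ν), ζ₀ p = 1 := by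
    have hz : ∀ᵐ z ∂P, ∀ᵐ ω ∂ν z, ζ₀ (z, ω) = 1 := by
      filter_upwards [hν, H₀1, ae_integrable_of_compProd H₀.integrable] with z hprob h1 hi
      have hnn : 0 ≤ᵐ[ν z] fun ω => σ * (ζ₀ (z, ω) - 1) :=
        ae_of_all _ fun ω => (hdom _ (H₀.ne_top _)).1
      have hi' : Integrable (fun ω => σ * (ζ₀ (z, ω) - 1)) (ν z) :=
        (hi.sub (integrable_const 1)).const_mul σ
      have h0 : ∫ ω, σ * (ζ₀ (z, ω) - 1) ∂ν z = 0 := by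
        rw [integral_const_mul, integral_sub hi (integrable_const 1), h1]
        simp
      filter_upwards [(integral_eq_zero_iff_of_nonneg_ae hnn hi').1 h0] with ω hω
      have : σ * (ζ₀ (z, ω) - 1) = 0 := hω
      linear_combination σ * this - (ζ₀ (z, ω) - 1) * hσ
    exact (Measure.ae_compProd_iff (measurableSet_eq_fun H₀.measurable measurable_const)).2 hz
  have hneg : ∫⁻ p, (-F p).toENNReal ∂(P ⊗ₘ ν) ≠ ⊤ := by
    refine ne_of_eq_of_ne (lintegral_congr_ae ?_) H₀.lintegral_neg.ne
    filter_upwards [hone] with p hp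
    rw [hp, ENNReal.ofReal_one, mul_one]
  have hφ1 : φ 1 = 0 := hφ.map_one
  have hFm : Measurable fun p => (-F p).toENNReal := measurable_ereal_toENNReal.comp hF.neg
  have Hone : ∀ N : ℕ, Admissible F φ η (P ⊗ₘ ν) (fun _ => 1)
      (fun p => (min (F p) ((N : ℝ) : EReal)).toReal) := fun N =>
    { measurable := measurable_const
      measurable_gain := (hF.min measurable_const).ereal_toReal
      nonneg := fun _ => zero_le_one
      integrable := integrable_const _
      integrable_gain := integrable_toReal_min hF hneg N
      lintegral_neg := by simpa using hneg.lt_top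
      lintegral_div := by simp [hφ1]
      ne_top := fun _ => by simp [hφ1]
      gain_le := fun p => by
        refine ⟨(min (F p) ((N : ℝ) : EReal)).toReal, ?_, by rw [hφ1]; simp⟩
        rw [EReal.coe_toReal]
        · exact min_le_left _ _
        · exact ne_top_of_le_ne_top (EReal.coe_ne_top _) (min_le_right _ _)
        · rcases min_choice (F p) ((N : ℝ) : EReal) with h | h
          · rw [h]; exact hbot _
          · rw [h]; exact EReal.coe_ne_bot _ }
  refine expect_fibreDual_le_of_family hφ hf Hone (fun N => ?_) ?_ hB
  · filter_upwards [hν] with z hprob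
    simp
  · have hneg' := hneg
    rw [Measure.lintegral_compProd hFm] at hneg'
    filter_upwards [hν, ae_lt_top hFm.lintegral_kernel_prod_right' hneg'] with z hprob hz
    refine (fibreDual_le_expect hη hf hz.ne hσ hdom).trans ?_
    refine expect_le_iSup_integral (fun N => integrable_toReal_min hf hz.ne N)
      ?_ ?_
    · refine ae_of_all _ fun ω N M hNM => ?_
      refine EReal.toReal_le_toReal (min_le_min_left _ (EReal.coe_le_coe_iff.2
        (Nat.cast_le.2 hNM))) ?_ (ne_top_of_le_ne_top (EReal.coe_ne_top _) (min_le_right _ _))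
      rcases min_choice (f ω) ((N : ℝ) : EReal) with h | h
      · rw [h]; exact hbot _
      · rw [h]; exact EReal.coe_ne_bot _
    · refine ae_of_all _ fun ω => ?_
      induction hfω : f ω with
      | bot => exact bot_le
      | top =>
        refine (EReal.eq_top_iff_forall_lt _ |>.2 fun y => ?_).ge
        obtain ⟨N, hN⟩ := exists_nat_gt y
        refine lt_of_lt_of_le (EReal.coe_lt_coe_iff.2 hN) (le_iSup_of_le N ?_)
        rw [min_eq_right le_top, EReal.toReal_coe]
      | coe r =>
        obtain ⟨N, hN⟩ := exists_nat_ge r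
        refine le_iSup_of_le N ?_
        rw [min_eq_left (EReal.coe_le_coe_iff.2 hN), EReal.toReal_coe]

theorem expect_fibreDual_le (hν : ∀ᵐ z ∂P, IsProbabilityMeasure (ν z))
    (hφ : IsDivergenceFunction φ) (hη : 0 < η) (hf : Measurable f) (hbot : ∀ ω, f ω ≠ ⊥)
    (hφdom : (∃ t : ℝ, t < 1 ∧ φ t ≠ ⊤) ∨ (∃ t : ℝ, 1 < t ∧ φ t = ⊤))
    {ζ₀ h₀ : Z × Ω → ℝ} (H₀ : Admissible (fun p : Z × Ω => f p.2) φ η (P ⊗ₘ ν) ζ₀ h₀)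
    (H₀1 : ∀ᵐ z ∂P, ∫ ω, ζ₀ (z, ω) ∂ν z = 1) {B : EReal}
    (hB : ∀ ζ h : Z × Ω → ℝ, Admissible (fun p : Z × Ω => f p.2) φ η (P ⊗ₘ ν) ζ h →
      (∀ᵐ z ∂P, ∫ ω, ζ (z, ω) ∂ν z = 1) → ((∫ p, h p ∂(P ⊗ₘ ν) : ℝ) : EReal) ≤ B) :
    expect P (fun z => fibreDual (ν z) φ η f) ≤ B := by
  by_cases hgt : ∃ t, 1 < t ∧ φ t ≠ ⊤
  · by_cases hlt : ∃ t, t < 1 ∧ φ t ≠ ⊤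
    · exact expect_fibreDual_le_of_interior hν hφ hη hf hbot hlt hgt H₀ H₀1 hB
    · obtain ⟨b, hb, hbtop⟩ := hφdom.resolve_left hlt
      refine expect_fibreDual_le_of_one_sided (σ := 1) (C := b - 1) hν hφ hη hf hbot (by norm_num)
        (fun t ht => ?_) H₀ H₀1 hB
      have h1 : 1 ≤ t := not_lt.1 fun h => hlt ⟨t, h, ht⟩
      refine ⟨by linarith, ?_⟩
      by_contra! hcon
      -- By convexity `φ` is finite between `1` and `t`, hence at `b`.
      have hpos : 0 < t - 1 := by linarith
      have := (hφ.convex_toReal (x := 1) (y := t) (a := (t - b) / (t - 1)) (b := (b - 1) / (t - 1))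
        (by simp [hφ.map_one]) ht (div_nonneg (by linarith) hpos.le)
        (div_nonneg (by linarith) hpos.le) (by field_simp; ring)).1
      refine this ?_
      rw [← hbtop]
      congr 1
      field_simp
      ring
  · refine expect_fibreDual_le_of_one_sided (σ := -1) (C := 1) hν hφ hη hf hbot (by norm_num)
      (fun t ht => ?_) H₀ H₀1 hB
    have h1 : t ≤ 1 := not_lt.1 fun h => hgt ⟨t, h, ht⟩
    have h2 := hφ.nonneg_of_ne_top ht
    constructor <;> linarith

end Strong


/-! ### The uniform kernel and its densities -/

section Uniform

variable {E : Type*} [NormedAddCommGroup E] [MeasurableSpace E]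

/-- The density of the uniform distribution on the ball of radius `ρ` around `z`. -/
noncomputable def ballDensity (vol : Measure E) (𝒵 : Set E) (ρ : ℝ) (z ω : 𝒵) : ℝ≥0∞ :=
  (ballVol vol ρ)⁻¹ * (closedBall (z : E) ρ).indicator 1 (ω : E)

theorem ballDensity_eq_zero {vol : Measure E} {𝒵 : Set E} {ρ : ℝ} {z ω : 𝒵}
    (h : (ω : E) ∉ closedBall (z : E) ρ) : ballDensity vol 𝒵 ρ z ω = 0 := by
  unfold ballDensity
  rw [Set.indicator_of_notMem h, mul_zero]

theorem ballVol_ne_zero (vol : Measure E) [vol.IsAddHaarMeasure] {ρ : ℝ} (hρ : 0 < ρ) :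
    ballVol vol ρ ≠ 0 :=
  (measure_closedBall_pos vol 0 hρ).ne'

theorem unifBall_univ [BorelSpace E] (vol : Measure E) {𝒵 : Set E} (h𝒵 : MeasurableSet 𝒵)
    (ρ : ℝ) (z : 𝒵) :
    unifBall vol 𝒵 ρ z Set.univ = (ballVol vol ρ)⁻¹ * vol (closedBall (z : E) ρ ∩ 𝒵) := by
  have hB : MeasurableSet ((↑) ⁻¹' closedBall (z : E) ρ : Set 𝒵) :=
    measurable_subtype_coe measurableSet_closedBall
  have e : ∀ ω : 𝒵, (closedBall (z : E) ρ).indicator (1 : E → ℝ≥0∞) (ω : E) =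
      ((↑) ⁻¹' closedBall (z : E) ρ : Set 𝒵).indicator 1 ω := fun ω => by
    by_cases h : (ω : E) ∈ closedBall (z : E) ρ
    · rw [Set.indicator_of_mem h, Set.indicator_of_mem (Set.mem_preimage.2 h)]; rfl
    · rw [Set.indicator_of_notMem h, Set.indicator_of_notMem (Set.mem_preimage.not.2 h)]
  unfold unifBall
  rw [withDensity_apply _ MeasurableSet.univ, Measure.restrict_univ]
  simp only [e]
  rw [lintegral_const_mul _ (measurable_one.indicator hB), lintegral_indicator_one hB, volOn,
    comap_subtype_coe_apply h𝒵, Set.image_preimage_eq_inter_range, Subtype.range_coe]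

variable [NormedSpace ℝ E] [FiniteDimensional ℝ E]

theorem ballVol_ne_top (vol : Measure E) [vol.IsAddHaarMeasure] (ρ : ℝ) : ballVol vol ρ ≠ ⊤ := by
  have : ProperSpace E := FiniteDimensional.proper ℝ E
  exact measure_closedBall_lt_top.ne

theorem sigmaFinite_volOn (vol : Measure E) [vol.IsAddHaarMeasure] {𝒵 : Set E}
    (h𝒵 : MeasurableSet 𝒵) : SigmaFinite (volOn vol 𝒵) := by
  have : ProperSpace E := FiniteDimensional.proper ℝ E
  refine SigmaFinite.of_map (volOn vol 𝒵) measurable_subtype_coe.aemeasurable ?_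
  unfold volOn
  rw [map_comap_subtype_coe h𝒵]
  infer_instance

variable [BorelSpace E]

theorem measurable_ballDensity (vol : Measure E) {𝒵 : Set E} (ρ : ℝ) :
    Measurable (Function.uncurry (ballDensity vol 𝒵 ρ)) := by
  have : ProperSpace E := FiniteDimensional.proper ℝ E
  have hS : MeasurableSet {p : 𝒵 × 𝒵 | dist (p.2 : E) (p.1 : E) ≤ ρ} :=
    measurableSet_le ((measurable_subtype_coe.comp measurable_snd).dist
      (measurable_subtype_coe.comp measurable_fst)) measurable_const
  have e : Function.uncurry (ballDensity vol 𝒵 ρ) = fun p => (ballVol vol ρ)⁻¹ *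
      {p : 𝒵 × 𝒵 | dist (p.2 : E) (p.1 : E) ≤ ρ}.indicator 1 p := by
    funext p
    simp [Function.uncurry, ballDensity, Set.indicator, mem_closedBall]
  rw [e]
  exact (measurable_one.indicator hS).const_mul _

variable (vol : Measure E) [vol.IsAddHaarMeasure] {𝒵 : Set E} (h𝒵 : MeasurableSet 𝒵) (ρ : ℝ)

/-- The uniform distributions `z ↦ ν_z` as a kernel. -/
noncomputable def unifKernel (vol : Measure E) [vol.IsAddHaarMeasure] (h𝒵 : MeasurableSet 𝒵) (ρ : ℝ) :
    Kernel 𝒵 𝒵 where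
  toFun := unifBall vol 𝒵 ρ
  measurable' := by
    have := sigmaFinite_volOn vol h𝒵
    refine Measure.measurable_of_measurable_coe _ fun s hs => ?_
    have e : ∀ z, unifBall vol 𝒵 ρ z s = ∫⁻ ω in s, ballDensity vol 𝒵 ρ z ω ∂volOn vol 𝒵 :=
      fun z => withDensity_apply _ hs
    simp only [e]
    exact (measurable_ballDensity vol ρ).lintegral_prod_right'

theorem unifKernel_apply (z : 𝒵) : unifKernel vol h𝒵 ρ z = unifBall vol 𝒵 ρ z := rfl

theorem isFiniteKernel_unifKernel {ρ : ℝ} (hρ : 0 < ρ) :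
    IsFiniteKernel (unifKernel vol h𝒵 ρ) := by
  refine ⟨⟨1, ENNReal.one_lt_top, fun z => ?_⟩⟩
  rw [unifKernel_apply, unifBall_univ vol h𝒵]
  calc _ ≤ (ballVol vol ρ)⁻¹ * vol (closedBall (z : E) ρ) := by gcongr; exact Set.inter_subset_left
    _ = 1 := by
      rw [Measure.addHaar_closedBall_center]
      exact ENNReal.inv_mul_cancel (ballVol_ne_zero vol hρ) (ballVol_ne_top vol ρ)

theorem isProbabilityMeasure_unifKernel {ρ : ℝ} (hρ : 0 < ρ) {z : 𝒵}
    (hz : closedBall (z : E) ρ ⊆ 𝒵) : IsProbabilityMeasure (unifKernel vol h𝒵 ρ z) := by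
  refine ⟨?_⟩
  rw [unifKernel_apply, unifBall_univ vol h𝒵, Set.inter_eq_self_of_subset_left hz,
    Measure.addHaar_closedBall_center]
  exact ENNReal.inv_mul_cancel (ballVol_ne_zero vol hρ) (ballVol_ne_top vol ρ)

theorem refTransport_eq_compProd {ρ : ℝ} (hρ : 0 < ρ) (P : Measure 𝒵) [SFinite P] :
    refTransport vol 𝒵 ρ P = P ⊗ₘ unifKernel vol h𝒵 ρ := by
  have := isFiniteKernel_unifKernel vol h𝒵 hρ
  have hm : ∀ s, MeasurableSet s → ∀ z, (unifBall vol 𝒵 ρ z).map (Prod.mk z) s =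
      unifKernel vol h𝒵 ρ z (Prod.mk z ⁻¹' s) := fun s hs z => by
    rw [Measure.map_apply measurable_prodMk_left hs, unifKernel_apply]
  have hmeas : Measurable fun z => (unifBall vol 𝒵 ρ z).map (Prod.mk z) := by
    refine Measure.measurable_of_measurable_coe _ fun s hs => ?_
    simp only [hm s hs]
    exact Kernel.measurable_kernel_prodMk_left hs
  ext s hs
  unfold refTransport
  rw [Measure.bind_apply hs hmeas.aemeasurable, Measure.compProd_apply hs]
  simp only [hm s hs]

section Density

variable {ρ : ℝ} {P : Measure 𝒵}

/-- The transport with density `ζ` with respect to the reference transport. -/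
noncomputable def densityTransport (vol : Measure E) [vol.IsAddHaarMeasure] (h𝒵 : MeasurableSet 𝒵) (ρ : ℝ)
    (P : Measure 𝒵) (ζ : 𝒵 × 𝒵 → ℝ) : Measure (𝒵 × 𝒵) :=
  (P ⊗ₘ unifKernel vol h𝒵 ρ).withDensity fun p => ENNReal.ofReal (ζ p)

theorem lintegral_snd_densityTransport {ζ : 𝒵 × 𝒵 → ℝ} (hζ : Measurable ζ) {g : 𝒵 → ℝ≥0∞}
    (hg : Measurable g) : ∫⁻ ω, g ω ∂(densityTransport vol h𝒵 ρ P ζ).snd =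
      ∫⁻ p, g p.2 * ENNReal.ofReal (ζ p) ∂(P ⊗ₘ unifKernel vol h𝒵 ρ) := by
  have h : Measurable fun p : 𝒵 × 𝒵 => g p.2 := hg.comp measurable_snd
  rw [Measure.snd, lintegral_map hg measurable_snd, densityTransport,
    lintegral_withDensity_eq_lintegral_mul _ hζ.ennreal_ofReal h]
  refine lintegral_congr fun p => ?_
  rw [Pi.mul_apply, mul_comm]

variable (hρ : 0 < ρ) [IsProbabilityMeasure P] {φ : ℝ → ℝ≥0∞} {η : ℝ} {f : 𝒵 → EReal}

include hρ in
theorem fst_densityTransport_apply {ζ : 𝒵 × 𝒵 → ℝ} (hζ : Measurable ζ) {A : Set 𝒵}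
    (hA : MeasurableSet A) : (densityTransport vol h𝒵 ρ P ζ).fst A =
      ∫⁻ z in A, ∫⁻ ω, ENNReal.ofReal (ζ (z, ω)) ∂unifKernel vol h𝒵 ρ z ∂P := by
  have := isFiniteKernel_unifKernel vol h𝒵 hρ
  rw [Measure.fst_apply hA, densityTransport, withDensity_apply _ (measurable_fst hA),
    ← Set.prod_univ, Measure.setLIntegral_compProd hζ.ennreal_ofReal hA MeasurableSet.univ]
  simp only [Measure.restrict_univ]

include hρ in
theorem objective_densityTransport (hφ : IsDivergenceFunction φ) (hη : 0 < η) (hf : Measurable f)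
    {ζ : 𝒵 × 𝒵 → ℝ} (hζ : Measurable ζ)
    (hζ0 : ∀ᵐ p ∂(P ⊗ₘ unifKernel vol h𝒵 ρ), 0 ≤ ζ p) :
    objective vol 𝒵 ρ P φ f η (densityTransport vol h𝒵 ρ P ζ).snd
      (densityTransport vol h𝒵 ρ P ζ) =
      ((∫⁻ p, gainPos (fun p : 𝒵 × 𝒵 => f p.2) ζ p ∂(P ⊗ₘ unifKernel vol h𝒵 ρ) : ℝ≥0∞) : EReal) -
      ((∫⁻ p, gainNeg (fun p : 𝒵 × 𝒵 => f p.2) φ η ζ p ∂(P ⊗ₘ unifKernel vol h𝒵 ρ) : ℝ≥0∞) :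
        EReal) := by
  have := isFiniteKernel_unifKernel vol h𝒵 hρ
  have hF : Measurable fun p : 𝒵 × 𝒵 => f p.2 := hf.comp measurable_snd
  have hdiv : phiDiv φ (densityTransport vol h𝒵 ρ P ζ) (P ⊗ₘ unifKernel vol h𝒵 ρ) =
      ∫⁻ p, φ (ζ p) ∂(P ⊗ₘ unifKernel vol h𝒵 ρ) := by
    have hac : densityTransport vol h𝒵 ρ P ζ ≪ P ⊗ₘ unifKernel vol h𝒵 ρ :=
      withDensity_absolutelyContinuous _ _
    unfold phiDiv
    rw [if_pos hac]
    refine lintegral_congr_ae ?_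
    filter_upwards [Measure.rnDeriv_withDensity (P ⊗ₘ unifKernel vol h𝒵 ρ) hζ.ennreal_ofReal,
      hζ0] with p hp h0
    rw [densityTransport, hp, ENNReal.toReal_ofReal h0]
  unfold objective expect
  rw [refTransport_eq_compProd vol h𝒵 hρ, hdiv, lintegral_gainNeg hF hφ hζ,
    lintegral_snd_densityTransport vol h𝒵 (g := fun ω => (f ω).toENNReal) hζ
      (measurable_ereal_toENNReal.comp hf),
    lintegral_snd_densityTransport vol h𝒵 (g := fun ω => (-f ω).toENNReal) hζ
      (measurable_ereal_toENNReal.comp hf.neg),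
    EReal.coe_ennreal_add, EReal.coe_ennreal_mul, EReal.coe_ennreal_ofReal, max_eq_left hη.le]
  have h1 : (η : EReal) * ((∫⁻ p, φ (ζ p) ∂(P ⊗ₘ unifKernel vol h𝒵 ρ) : ℝ≥0∞) : EReal) ≠ ⊥ :=
    ne_bot_of_le_ne_bot EReal.zero_ne_bot
      (mul_nonneg (EReal.coe_nonneg.2 hη.le) (EReal.coe_ennreal_nonneg _))
  rw [sub_eq_add_neg, sub_eq_add_neg, add_assoc, sub_eq_add_neg (_ : EReal) (_ + _),
    EReal.neg_add (Or.inl (EReal.coe_ennreal_ne_bot _)) (Or.inr h1), ← sub_eq_add_neg (-_ : EReal)]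
  rfl

include hρ in
theorem isFeasible_densityTransport {ζ : 𝒵 × 𝒵 → ℝ} (hζ : Measurable ζ)
    (hζ1 : ∀ᵐ z ∂P, ∫⁻ ω, ENNReal.ofReal (ζ (z, ω)) ∂unifKernel vol h𝒵 ρ z = 1) :
    IsFeasible 𝒵 ρ P (densityTransport vol h𝒵 ρ P ζ).snd (densityTransport vol h𝒵 ρ P ζ) := by
  have := isFiniteKernel_unifKernel vol h𝒵 hρ
  have : ProperSpace E := FiniteDimensional.proper ℝ E
  refine ⟨?_, rfl, ?_⟩
  · ext A hA
    rw [fst_densityTransport_apply vol h𝒵 hρ hζ hA,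
      lintegral_congr_ae (ae_restrict_of_ae hζ1), setLIntegral_one]
  · refine essSup_le_of_ae_le _ ?_
    refine (withDensity_absolutelyContinuous (P ⊗ₘ unifKernel vol h𝒵 ρ) _).ae_le ?_
    refine (Measure.ae_compProd_iff (measurableSet_le
      (((measurable_subtype_coe.comp measurable_fst).sub
        (measurable_subtype_coe.comp measurable_snd)).enorm) measurable_const)).2 ?_
    refine ae_of_all _ fun z => ?_
    rw [unifKernel_apply]
    refine (ae_withDensity_iff (f := ballDensity vol 𝒵 ρ z)
      ((measurable_ballDensity vol ρ).comp measurable_prodMk_left)).2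
      (ae_of_all _ fun ω hω => ?_)
    have h : (ω : E) ∈ closedBall (z : E) ρ := by
      by_contra h
      exact hω (ballDensity_eq_zero h)
    rw [mem_closedBall, dist_comm, dist_eq_norm] at h
    rw [← ofReal_norm]
    exact ENNReal.ofReal_le_ofReal h

include hρ in
/-- Every feasible transport with finite divergence has a normalized density with values in the
effective domain of `φ`. -/
theorem IsFeasible.exists_density (hφ : IsDivergenceFunction φ) {Q : Measure 𝒵}
    {γ : Measure (𝒵 × 𝒵)} (h : IsFeasible 𝒵 ρ P Q γ)
    (hdiv : phiDiv φ γ (refTransport vol 𝒵 ρ P) ≠ ⊤) :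
    ∃ ζ : 𝒵 × 𝒵 → ℝ, Measurable ζ ∧ (∀ p, φ (ζ p) ≠ ⊤) ∧
      (∀ᵐ z ∂P, ∫⁻ ω, ENNReal.ofReal (ζ (z, ω)) ∂unifKernel vol h𝒵 ρ z = 1) ∧
      γ = densityTransport vol h𝒵 ρ P ζ ∧ Q = (densityTransport vol h𝒵 ρ P ζ).snd ∧
      ∫⁻ p, φ (ζ p) ∂(P ⊗ₘ unifKernel vol h𝒵 ρ) ≠ ⊤ := by
  classical
  have := isFiniteKernel_unifKernel vol h𝒵 hρ
  rw [refTransport_eq_compProd vol h𝒵 hρ] at hdiv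
  set γ₀ := P ⊗ₘ unifKernel vol h𝒵 ρ with hγ₀
  have hfin : IsFiniteMeasure γ := ⟨by
    rw [← Measure.fst_univ, h.fst_eq]
    exact measure_lt_top _ _⟩
  have hac : γ ≪ γ₀ := by
    by_contra hac
    exact hdiv (if_neg hac)
  unfold phiDiv at hdiv
  rw [if_pos hac] at hdiv
  have hrm : Measurable fun p => (γ.rnDeriv γ₀ p).toReal :=
    (Measure.measurable_rnDeriv γ γ₀).ennreal_toReal
  have hφm := hφ.lowerSemicontinuous.measurable
  let ζ : 𝒵 × 𝒵 → ℝ := fun p =>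
    if φ ((γ.rnDeriv γ₀ p).toReal) = ⊤ then 1 else (γ.rnDeriv γ₀ p).toReal
  have hζ : Measurable ζ :=
    Measurable.ite (hφm.comp hrm (measurableSet_singleton ⊤)) measurable_const hrm
  have hae : ∀ᵐ p ∂γ₀, ζ p = (γ.rnDeriv γ₀ p).toReal := by
    filter_upwards [ae_lt_top (hφm.comp hrm) hdiv] with p hp
    exact if_neg hp.ne
  have hγ : γ = densityTransport vol h𝒵 ρ P ζ := by
    rw [← Measure.withDensity_rnDeriv_eq γ γ₀ hac]
    refine withDensity_congr_ae ?_
    filter_upwards [hae, Measure.rnDeriv_lt_top γ γ₀] with p hp hp'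
    rw [hp, ENNReal.ofReal_toReal hp'.ne]
  refine ⟨ζ, hζ, fun p => ?_, ?_, hγ, ?_, ?_⟩
  · simp only [ζ]
    split_ifs with hp
    · simp [hφ.map_one]
    · exact hp
  · refine ae_eq_of_forall_setLIntegral_eq_of_sigmaFinite
      hζ.ennreal_ofReal.lintegral_kernel_prod_right' measurable_const fun A hA _ => ?_
    rw [← fst_densityTransport_apply vol h𝒵 hρ hζ hA, ← hγ, h.fst_eq, setLIntegral_one]
  · rw [← hγ, h.snd_eq]
  · rwa [lintegral_congr_ae (hae.mono fun p hp => by rw [hp])]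

include hρ in
/-- The second marginal of the transport with density `ζ`. Only the values of `ζ` almost everywhere
with respect to the reference transport matter, as the balls cut off all the others. -/
theorem worstCase_eq_snd {ζ : 𝒵 → 𝒵 → ℝ} {ζ' : 𝒵 × 𝒵 → ℝ} (hζ' : Measurable ζ')
    (hae : ∀ᵐ p ∂(P ⊗ₘ unifKernel vol h𝒵 ρ), Function.uncurry ζ p = ζ' p) :
    worstCase vol 𝒵 ρ P ζ = (densityTransport vol h𝒵 ρ P ζ').snd := by
  have := isFiniteKernel_unifKernel vol h𝒵 hρ
  have := sigmaFinite_volOn vol h𝒵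
  have hk := measurable_ballDensity vol ρ (𝒵 := 𝒵)
  obtain ⟨N, hN, hNm, hN0⟩ := exists_measurable_superset_of_null hae
  have hnull : ∀ᵐ ω ∂volOn vol 𝒵, ∀ᵐ z ∂P, (z, ω) ∈ N → ballDensity vol 𝒵 ρ z ω = 0 := by
    rw [Measure.ae_ae_comm (p := fun ω z => (z, ω) ∈ N → ballDensity vol 𝒵 ρ z ω = 0)]
    · filter_upwards [Measure.ae_ae_of_ae_compProd (measure_eq_zero_iff_ae_notMem.1 hN0)] with z hz
      have hz' : ∀ᵐ ω ∂unifBall vol 𝒵 ρ z, (z, ω) ∉ N := hz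
      filter_upwards [(ae_withDensity_iff (f := ballDensity vol 𝒵 ρ z)
        (hk.comp measurable_prodMk_left)).1 hz'] with ω hω hmem
      by_contra h
      exact hω h hmem
    · have h1 : MeasurableSet {p : 𝒵 × 𝒵 | (p.2, p.1) ∈ N} := measurable_swap hNm
      have h2 : MeasurableSet {p : 𝒵 × 𝒵 | ballDensity vol 𝒵 ρ p.2 p.1 = 0} :=
        (hk.comp measurable_swap) (measurableSet_singleton 0)
      have e : {p : 𝒵 × 𝒵 | (p.2, p.1) ∈ N → ballDensity vol 𝒵 ρ p.2 p.1 = 0} =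
          {p : 𝒵 × 𝒵 | (p.2, p.1) ∈ N}ᶜ ∪ {p : 𝒵 × 𝒵 | ballDensity vol 𝒵 ρ p.2 p.1 = 0} := by
        ext p
        simp [imp_iff_not_or]
      exact e ▸ h1.compl.union h2
  have hprod : Measurable fun p : 𝒵 × 𝒵 => ballDensity vol 𝒵 ρ p.1 p.2 * ENNReal.ofReal (ζ' p) :=
    hk.mul hζ'.ennreal_ofReal
  have hdens : (fun ω => (ballVol vol ρ)⁻¹ *
      ∫⁻ z, (closedBall (z : E) ρ).indicator 1 (ω : E) * ENNReal.ofReal (ζ z ω) ∂P) =ᵐ[volOn vol 𝒵]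
      fun ω => ∫⁻ z, ballDensity vol 𝒵 ρ z ω * ENNReal.ofReal (ζ' (z, ω)) ∂P := by
    filter_upwards [hnull] with ω hω
    rw [← lintegral_const_mul' _ _ (ENNReal.inv_ne_top.2 (ballVol_ne_zero vol hρ))]
    refine lintegral_congr_ae ?_
    filter_upwards [hω] with z hz
    rw [← mul_assoc]
    change ballDensity vol 𝒵 ρ z ω * _ = _
    by_cases hmem : (z, ω) ∈ N
    · rw [hz hmem, zero_mul, zero_mul]
    · have : ζ z ω = ζ' (z, ω) := by
        by_contra hne
        exact hmem (hN hne)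
      rw [this]
  unfold worstCase
  rw [withDensity_congr_ae hdens]
  ext A hA
  have hunif : ∀ z, ∫⁻ ω in A, ENNReal.ofReal (ζ' (z, ω)) ∂unifKernel vol h𝒵 ρ z =
      ∫⁻ ω in A, ballDensity vol 𝒵 ρ z ω * ENNReal.ofReal (ζ' (z, ω)) ∂volOn vol 𝒵 := fun z => by
    rw [unifKernel_apply]
    exact setLIntegral_withDensity_eq_setLIntegral_mul (volOn vol 𝒵)
      (f := ballDensity vol 𝒵 ρ z) (hk.comp measurable_prodMk_left)
      (hζ'.comp measurable_prodMk_left).ennreal_ofReal hA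
  rw [withDensity_apply _ hA, Measure.snd_apply hA, densityTransport,
    withDensity_apply _ (measurable_snd hA), ← Set.univ_prod,
    Measure.setLIntegral_compProd hζ'.ennreal_ofReal MeasurableSet.univ hA]
  simp only [Measure.restrict_univ, hunif]
  exact lintegral_lintegral_swap (hprod.comp measurable_swap).aemeasurable

end Density

end Uniform


/-! ### The duality theorem -/

theorem lintegral_ofReal_eq_one {Ω : Type*} [MeasurableSpace Ω] {ν : Measure Ω} {u : Ω → ℝ}
    (h0 : ∀ᵐ ω ∂ν, 0 ≤ u ω) (h1 : ∫ ω, u ω ∂ν = 1) :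
    ∫⁻ ω, ENNReal.ofReal (u ω) ∂ν = 1 := by
  have hi : Integrable u ν := by
    by_contra hi
    rw [integral_undef hi] at h1
    exact zero_ne_one h1
  rw [← ofReal_integral_eq_lintegral_ofReal hi h0, h1, ENNReal.ofReal_one]

/-- A density at which the negative part of the objective is finite is admissible: the gain is
bounded below by its negative part. -/
theorem admissible_of_lintegral_gainNeg {X : Type*} [MeasurableSpace X] {γ : Measure X}
    [IsFiniteMeasure γ] {F : X → EReal} {φ : ℝ → ℝ≥0∞} {η : ℝ} {ζ : X → ℝ}
    (hφ : IsDivergenceFunction φ) (hη : 0 < η) (hF : Measurable F) (hbot : ∀ x, F x ≠ ⊥)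
    (hζ : Measurable ζ) (hne : ∀ x, φ (ζ x) ≠ ⊤) (hint : Integrable ζ γ)
    (hneg : ∫⁻ x, (-F x).toENNReal * ENNReal.ofReal (ζ x) ∂γ ≠ ⊤)
    (hdiv : ∫⁻ x, φ (ζ x) ∂γ ≠ ⊤) :
    Admissible F φ η γ ζ fun x => -(gainNeg F φ η ζ x).toReal where
  measurable := hζ
  measurable_gain := (measurable_gainNeg hφ hF hζ).ennreal_toReal.neg
  nonneg x := hφ.nonneg_of_ne_top (hne x)
  integrable := hint
  integrable_gain := by
    refine (integrable_toReal_of_lintegral_ne_top (measurable_gainNeg hφ hF hζ).aemeasurable ?_).neg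
    rw [lintegral_gainNeg hF hφ hζ]
    exact ENNReal.add_ne_top.2 ⟨hneg, ENNReal.mul_ne_top ENNReal.ofReal_ne_top hdiv⟩
  lintegral_neg := hneg.lt_top
  lintegral_div := hdiv.lt_top
  ne_top := hne
  gain_le x := by
    have h : (-F x).toENNReal ≠ ⊤ := by simpa using hbot x
    refine ⟨-(-F x).toENNReal.toReal, ?_, le_of_eq ?_⟩
    · rw [EReal.coe_neg, EReal.coe_ennreal_toReal h, EReal.coe_toENNReal_eq_max, EReal.neg_le]
      exact le_max_right _ _
    · unfold gainNeg
      rw [ENNReal.toReal_add (ENNReal.mul_ne_top h ENNReal.ofReal_ne_top)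
        (ENNReal.mul_ne_top ENNReal.ofReal_ne_top (hne x)), ENNReal.toReal_mul,
        ENNReal.toReal_mul, ENNReal.toReal_ofReal hη.le,
        ENNReal.toReal_ofReal (hφ.nonneg_of_ne_top (hne x))]
      ring

theorem objective_le_primalValue {E : Type*} [NormedAddCommGroup E] [MeasurableSpace E]
    {vol : Measure E} {𝒵 : Set E} {ρ : ℝ} {P : Measure 𝒵} {φ : ℝ → ℝ≥0∞} {η : ℝ} {f : 𝒵 → EReal}
    {Q : Measure 𝒵} {γ : Measure (𝒵 × 𝒵)} (h : IsFeasible 𝒵 ρ P Q γ) :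
    objective vol 𝒵 ρ P φ f η Q γ ≤ primalValue vol 𝒵 ρ P φ f η :=
  le_sSup ⟨Q, γ, h, rfl⟩

section Duality

variable {E : Type*} [NormedAddCommGroup E] [MeasurableSpace E]
  [NormedSpace ℝ E] [FiniteDimensional ℝ E] [BorelSpace E] {vol : Measure E}
  [vol.IsAddHaarMeasure] {𝒵 : Set E} {ρ : ℝ} {P : Measure 𝒵}
  {φ : ℝ → ℝ≥0∞} {η : ℝ} {f : 𝒵 → EReal}

theorem dualValue_eq_expect_fibreDual (h𝒵 : MeasurableSet 𝒵) :
    dualValue vol 𝒵 ρ P φ f η = expect P fun z => fibreDual (unifKernel vol h𝒵 ρ z) φ η f :=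
  rfl

variable [IsProbabilityMeasure P]

/-- Weak duality: a feasible transport of finite divergence has a density. -/
theorem primalValue_le_dualValue (h𝒵 : MeasurableSet 𝒵) (hρ : 0 < ρ)
    (hφ : IsDivergenceFunction φ) (hf : Measurable f) (hfbot : ∀ z, f z ≠ ⊥) (hη : 0 < η) :
    primalValue vol 𝒵 ρ P φ f η ≤ dualValue vol 𝒵 ρ P φ f η := by
  have := isFiniteKernel_unifKernel vol h𝒵 hρ
  refine sSup_le ?_
  rintro _ ⟨Q, γ, hfeas, rfl⟩
  by_cases hdiv : phiDiv φ γ (refTransport vol 𝒵 ρ P) = ⊤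
  · unfold objective
    rw [hdiv, coe_mul_coe_top hη, sub_eq_add_neg, EReal.neg_top, EReal.add_bot]
    exact bot_le
  obtain ⟨ζ, hζ, hne, h1, rfl, rfl, -⟩ := hfeas.exists_density vol h𝒵 hρ hφ hdiv
  have h0 : ∀ p, 0 ≤ ζ p := fun p => hφ.nonneg_of_ne_top (hne p)
  rw [objective_densityTransport vol h𝒵 hρ hφ hη hf hζ (ae_of_all _ h0)]
  by_cases hneg : ∫⁻ p, gainNeg (fun p : 𝒵 × 𝒵 => f p.2) φ η ζ p ∂(P ⊗ₘ unifKernel vol h𝒵 ρ) = ⊤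
  · rw [hneg, EReal.coe_ennreal_top, sub_eq_add_neg, EReal.neg_top, EReal.add_bot]
    exact bot_le
  rw [dualValue_eq_expect_fibreDual h𝒵]
  exact lintegral_gain_le_expect_fibreDual hφ hη hf hfbot hζ
    (ae_of_all _ fun z => ae_of_all _ fun ω => h0 _) h1 (Or.inr hneg)

theorem dualValue_le_primalValue (h𝒵 : MeasurableSet 𝒵) (hρ : 0 < ρ)
    (hball : ∀ᵐ z : 𝒵 ∂P, closedBall (z : E) ρ ⊆ 𝒵)
    (hφ : IsDivergenceFunction φ)
    (hφdom : (∃ t : ℝ, t < 1 ∧ φ t ≠ ⊤) ∨ (∃ t : ℝ, 1 < t ∧ φ t = ⊤))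
    (hf : Measurable f) (hfbot : ∀ z, f z ≠ ⊥)
    (hproper : ∃ (Q : Measure 𝒵) (γ : Measure (𝒵 × 𝒵)), IsFeasible 𝒵 ρ P Q γ ∧
      ∫⁻ ω, (-f ω).toENNReal ∂Q < ⊤ ∧ phiDiv φ γ (refTransport vol 𝒵 ρ P) < ⊤)
    (hη : 0 < η) :
    dualValue vol 𝒵 ρ P φ f η ≤ primalValue vol 𝒵 ρ P φ f η := by
  have := isFiniteKernel_unifKernel vol h𝒵 hρ
  have hF : Measurable fun p : 𝒵 × 𝒵 => f p.2 := hf.comp measurable_snd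
  obtain ⟨Q, γ, hfeas, hneg, hdiv⟩ := hproper
  obtain ⟨ζ, hζ, hne, h1, rfl, rfl, hdiv'⟩ := hfeas.exists_density vol h𝒵 hρ hφ hdiv.ne
  have h0 : ∀ p, 0 ≤ ζ p := fun p => hφ.nonneg_of_ne_top (hne p)
  rw [lintegral_snd_densityTransport vol h𝒵 hζ (g := fun ω => (-f ω).toENNReal)
    (measurable_ereal_toENNReal.comp hf.neg)] at hneg
  have hint : Integrable ζ (P ⊗ₘ unifKernel vol h𝒵 ρ) := by
    refine ⟨hζ.aestronglyMeasurable, ?_⟩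
    rw [hasFiniteIntegral_iff_ofReal (ae_of_all _ h0),
      Measure.lintegral_compProd hζ.ennreal_ofReal, lintegral_congr_ae h1]
    simp
  rw [dualValue_eq_expect_fibreDual h𝒵]
  refine expect_fibreDual_le (ν := unifKernel vol h𝒵 ρ)
    (hball.mono fun z hz => isProbabilityMeasure_unifKernel vol h𝒵 hρ hz) hφ hη hf hfbot hφdom
    (admissible_of_lintegral_gainNeg hφ hη hF (fun p => hfbot p.2) hζ hne hint hneg.ne hdiv')
    ?_ fun ζ' h' H' H1' => ?_
  · filter_upwards [h1] with z hz
    rw [integral_eq_lintegral_of_nonneg_ae (ae_of_all _ fun ω => h0 _)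
      (hζ.comp measurable_prodMk_left).aestronglyMeasurable, hz, ENNReal.toReal_one]
  · refine (H'.integral_gain_le hφ hF (fun p => hfbot p.2) hη).trans ?_
    rw [← objective_densityTransport vol h𝒵 hρ hφ hη hf H'.measurable (ae_of_all _ H'.nonneg)]
    exact objective_le_primalValue (isFeasible_densityTransport vol h𝒵 hρ H'.measurable
      (H1'.mono fun z hz => lintegral_ofReal_eq_one (ae_of_all _ fun ω => H'.nonneg _) hz))

/-- The density made of subgradients attains the dual value, hence the primal one. Its measurable
version is used in the proof; the multipliers `μ` need not depend measurably on `z`. -/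
theorem isWorstCase_worstCase (h𝒵 : MeasurableSet 𝒵) (hρ : 0 < ρ)
    (hφ : IsDivergenceFunction φ) (hf : Measurable f) (hfbot : ∀ z, f z ≠ ⊥) (hη : 0 < η)
    {μ : 𝒵 → ℝ} {ζ : 𝒵 → 𝒵 → ℝ}
    (hζ : AEMeasurable (Function.uncurry ζ) (refTransport vol 𝒵 ρ P))
    (hζμ : ∀ᵐ z ∂P,
      (∀ᵐ ω ∂(unifBall vol 𝒵 ρ z), 0 ≤ ζ z ω) ∧
      ∫ ω, ζ z ω ∂(unifBall vol 𝒵 ρ z) = 1 ∧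
      ∀ᵐ ω ∂(unifBall vol 𝒵 ρ z), IsConjSubgradient η φ (f ω - (μ z : EReal)) (ζ z ω))
    (hfin : ∫⁻ p, (f p.2).toENNReal * ENNReal.ofReal (ζ p.1 p.2)
          ∂(refTransport vol 𝒵 ρ P) < ⊤ ∨
      (∫⁻ p, (-f p.2).toENNReal * ENNReal.ofReal (ζ p.1 p.2)
          ∂(refTransport vol 𝒵 ρ P) < ⊤ ∧
        ∫⁻ p, φ (ζ p.1 p.2) ∂(refTransport vol 𝒵 ρ P) < ⊤)) :
    IsWorstCase vol 𝒵 ρ P φ f η (worstCase vol 𝒵 ρ P ζ) := by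
  have := isFiniteKernel_unifKernel vol h𝒵 hρ
  have hF : Measurable fun p : 𝒵 × 𝒵 => f p.2 := hf.comp measurable_snd
  rw [refTransport_eq_compProd vol h𝒵 hρ] at hζ hfin
  obtain ⟨ζ', hζm, hae⟩ := hζ
  have haez : ∀ᵐ z ∂P, ∀ᵐ ω ∂unifKernel vol h𝒵 ρ z, ζ z ω = ζ' (z, ω) :=
    Measure.ae_ae_of_ae_compProd hae
  have h0 : ∀ᵐ z ∂P, ∀ᵐ ω ∂unifKernel vol h𝒵 ρ z, 0 ≤ ζ' (z, ω) := by
    filter_upwards [haez, hζμ] with z hz hz'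
    filter_upwards [hz, hz'.1] with ω hω hω'
    rwa [← hω]
  have h1 : ∀ᵐ z ∂P, ∫⁻ ω, ENNReal.ofReal (ζ' (z, ω)) ∂unifKernel vol h𝒵 ρ z = 1 := by
    filter_upwards [haez, h0, hζμ] with z hz hz0 hz'
    exact lintegral_ofReal_eq_one hz0 ((integral_congr_ae hz).symm.trans hz'.2.1)
  have hsub : ∀ᵐ z ∂P, ∀ᵐ ω ∂unifKernel vol h𝒵 ρ z,
      IsConjSubgradient η φ (f ω - (μ z : EReal)) (ζ' (z, ω)) := by
    filter_upwards [haez, hζμ] with z hz hz'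
    filter_upwards [hz, hz'.2.2] with ω hω hω'
    rwa [← hω]
  have hcongr : ∀ G : 𝒵 × 𝒵 → ℝ → ℝ≥0∞,
      ∫⁻ p, G p (ζ p.1 p.2) ∂(P ⊗ₘ unifKernel vol h𝒵 ρ) =
        ∫⁻ p, G p (ζ' p) ∂(P ⊗ₘ unifKernel vol h𝒵 ρ) := fun G =>
    lintegral_congr_ae (hae.mono fun p hp => congrArg (G p) hp)
  rw [hcongr fun p t => (f p.2).toENNReal * ENNReal.ofReal t,
    hcongr fun p t => (-f p.2).toENNReal * ENNReal.ofReal t, hcongr fun _ t => φ t] at hfin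
  have hfin' : ∫⁻ p, gainPos (fun p : 𝒵 × 𝒵 => f p.2) ζ' p ∂(P ⊗ₘ unifKernel vol h𝒵 ρ) ≠ ⊤ ∨
      ∫⁻ p, gainNeg (fun p : 𝒵 × 𝒵 => f p.2) φ η ζ' p ∂(P ⊗ₘ unifKernel vol h𝒵 ρ) ≠ ⊤ := by
    refine hfin.imp (fun h => h.ne) fun h => ?_
    rw [lintegral_gainNeg hF hφ hζm]
    exact ENNReal.add_ne_top.2 ⟨h.1.ne, ENNReal.mul_ne_top ENNReal.ofReal_ne_top h.2.ne⟩
  rw [worstCase_eq_snd vol h𝒵 hρ hζm hae]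
  have hfeas := isFeasible_densityTransport vol h𝒵 hρ hζm h1
  refine ⟨_, hfeas, le_antisymm (objective_le_primalValue hfeas) ?_⟩
  rw [objective_densityTransport vol h𝒵 hρ hφ hη hf hζm
    ((Measure.ae_compProd_iff (measurableSet_le measurable_const hζm)).2 h0)]
  refine (primalValue_le_dualValue h𝒵 hρ hφ hf hfbot hη).trans ?_
  rw [dualValue_eq_expect_fibreDual h𝒵]
  exact expect_fibreDual_le_lintegral_gain (ν := unifKernel vol h𝒵 ρ) hφ hη hf hfbot hζm h0 h1
    hsub hfin'

end Duality

end PhiRegDRO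

theorem theorem1 {E : Type*} [NormedAddCommGroup E] [NormedSpace ℝ E] [FiniteDimensional ℝ E]
    [MeasurableSpace E] [BorelSpace E] (vol : Measure E) [vol.IsAddHaarMeasure]
    (𝒵 : Set E) (h𝒵 : MeasurableSet 𝒵) (ρ : ℝ) (hρ : 0 < ρ)
    (Phat : Measure 𝒵) [IsProbabilityMeasure Phat]
    (hball : ∀ᵐ z : 𝒵 ∂Phat, closedBall (z : E) ρ ⊆ 𝒵)
    (φ : ℝ → ℝ≥0∞) (hφ : PhiRegDRO.IsDivergenceFunction φ)
    (hφdom : (∃ t : ℝ, t < 1 ∧ φ t ≠ ⊤) ∨ (∃ t : ℝ, 1 < t ∧ φ t = ⊤))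
    (f : 𝒵 → EReal) (hf : Measurable f) (hfbot : ∀ z, f z ≠ ⊥)
    (hcond : ∀ γ : Measure (𝒵 × 𝒵), IsProbabilityMeasure γ → γ.fst = Phat →
      ∃ κ : Kernel 𝒵 𝒵, IsMarkovKernel κ ∧ γ = Phat ⊗ₘ κ)
    (hproper : ∃ (P : Measure 𝒵) (γ : Measure (𝒵 × 𝒵)), PhiRegDRO.IsFeasible 𝒵 ρ Phat P γ ∧
      ∫⁻ ω, (-f ω).toENNReal ∂P < ⊤ ∧
      PhiRegDRO.phiDiv φ γ (PhiRegDRO.refTransport vol 𝒵 ρ Phat) < ⊤)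
    (η : ℝ) (hη : 0 < η) :
    PhiRegDRO.primalValue vol 𝒵 ρ Phat φ f η = PhiRegDRO.dualValue vol 𝒵 ρ Phat φ f η ∧
    ∀ (μ : 𝒵 → ℝ) (ζ : 𝒵 → 𝒵 → ℝ),
      AEMeasurable (Function.uncurry ζ) (PhiRegDRO.refTransport vol 𝒵 ρ Phat) →
      (∀ᵐ z ∂Phat,
        (∀ᵐ ω ∂(PhiRegDRO.unifBall vol 𝒵 ρ z), 0 ≤ ζ z ω) ∧
        ∫ ω, ζ z ω ∂(PhiRegDRO.unifBall vol 𝒵 ρ z) = 1 ∧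
        ∀ᵐ ω ∂(PhiRegDRO.unifBall vol 𝒵 ρ z),
          PhiRegDRO.IsConjSubgradient η φ (f ω - (μ z : EReal)) (ζ z ω)) →
      (∫⁻ p, (f p.2).toENNReal * ENNReal.ofReal (ζ p.1 p.2)
            ∂(PhiRegDRO.refTransport vol 𝒵 ρ Phat) < ⊤ ∨
        (∫⁻ p, (-f p.2).toENNReal * ENNReal.ofReal (ζ p.1 p.2)
            ∂(PhiRegDRO.refTransport vol 𝒵 ρ Phat) < ⊤ ∧
          ∫⁻ p, φ (ζ p.1 p.2) ∂(PhiRegDRO.refTransport vol 𝒵 ρ Phat) < ⊤)) →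
      PhiRegDRO.IsWorstCase vol 𝒵 ρ Phat φ f η (PhiRegDRO.worstCase vol 𝒵 ρ Phat ζ) := by
  exact ⟨le_antisymm (PhiRegDRO.primalValue_le_dualValue h𝒵 hρ hφ hf hfbot hη)
      (PhiRegDRO.dualValue_le_primalValue h𝒵 hρ hball hφ hφdom hf hfbot hproper hη),
    fun μ ζ hζ hζμ hfin =>
      PhiRegDRO.isWorstCase_worstCase h𝒵 hρ hφ hf hfbot hη hζ hζμ hfin⟩
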